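/- Let $p\in\mathbb C$ with $|p|<1$. For nonzero complex $x$ put $$\theta(x;p)=\prod_{j\ge 0}(1-p^jx)(1-p^{j+1}/x),\qquad \theta(x_1,\dots,x_m;p)=\prod_{i=1}^m\theta(x_i;p),$$ and, for $q\in\mathbb C\setminus\{0\}$ and integers $n\ge 0$, $x,x_1,\dots,x_m\ne 0$, $$(x;q,p)_n=\prod_{k=0}^{n-1}\theta(xq^k;p),\qquad (x_1,\dots,x_m;q,p)_n=\prod_{i=1}^m (x_i;q,p)_n .$$ For nonzero $z,a$ let $$\gamma(z,a;p)=\sum_{k=-\infty}^{\infty}\sum_{l=-\infty}^{\infty}p^{k^2+kl+l^2}a^{k+l}z^{k-l}$$ be Bhargava's cubic theta function. Define the cubic theta shifted factorial by $$\langle az,a/z;q,p\rangle_n=\prod_{j=0}^{n-1}\gamma\big(zq^{\frac{1-n}{2}+j},\,aq^{\frac{n-1}{2}};p\big).$$ Every pair $(X,Y)$ of nonzero complex numbers is of the form $(az,a/z)$, and $\langle X,Y;q,p\rangle_n$ depends neither on the choice of $(a,z)$ nor on the choice of $q^{1/2}$. Let $n\ge 0$ be an integer and let $a,b,c,z,q$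 be nonzero complex numbers such that none of the denominators below vanishes, that is, $(cz,c/z;q,p)_n\neq0$, $\theta(bcq^{-1};p)\ne0$, $(q,bcq^n;q,p)_n\ne 0$, and $\langle abq^n,aq^{-k}/b;q,p\rangle_k\neq 0$ for $0\le k\le n$. Then $$(bc,c/b;q,p)_n\,\frac{\langle az,a/z;q,p\rangle_n}{(cz,c/z;q,p)_n} =\sum_{k=0}^n q^{nk}\Big(\frac cb\Big)^k\frac{\theta(bcq^{2k-1};p)}{\theta(bcq^{-1};p)}\, \frac{(q^{-n},bcq^{-1},bz,b/z;q,p)_k}{(q,bcq^n,cz,c/z;q,p)_k}\, \langle acq^{n-1},aq^{1-k}/c;q,p\rangle_k\, \frac{\langle abq^k,aq^{-k}/b;q,p\rangle_n}{\langle abq^n,aq^{-k}/b;q,p\rangle_k}.$$ -/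

import Mathlib

noncomputable section

namespace CubicTheta

/-- The modified Jacobi theta function
`θ(x;p) = ∏_{j ≥ 0} (1 - p^j x)(1 - p^(j+1)/x)`, for `x ≠ 0` and `|p| < 1`. -/
def theta (x p : ℂ) : ℂ :=
  ∏' j : ℕ, ((1 - p ^ j * x) * (1 - p ^ (j + 1) / x))

/-- The theta shifted factorial `(a;q,p)_n = ∏_{k=0}^{n-1} θ(a q^k; p)`, for `n ≥ 0`. -/
def thetaFac (a q p : ℂ) (n : ℕ) : ℂ :=
  ∏ k ∈ Finset.range n, theta (a * q ^ k) p

/-- Bhargava's cubic theta function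
`γ(z,a;p) = ∑_{k,l ∈ ℤ} p^(k²+kl+l²) a^(k+l) z^(k-l)`.  The double series converges absolutely
for `z, a ≠ 0` and `|p| < 1`.  (The exponent of `p` is nonnegative, and `0 ^ 0 = 1`.) -/
def gamma (z a p : ℂ) : ℂ :=
  ∑' kl : ℤ × ℤ,
    p ^ (kl.1 ^ 2 + kl.1 * kl.2 + kl.2 ^ 2) * a ^ (kl.1 + kl.2) * z ^ (kl.1 - kl.2)

/-- The cubic theta shifted factorial in terms of the parameters `a` and `z`:
`∏_{j=0}^{n-1} γ(z q^((1-n)/2+j), a q^((n-1)/2); p)`. -/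
def cubicFacAux (a z q p : ℂ) (n : ℕ) : ℂ :=
  ∏ j ∈ Finset.range n,
    gamma (z * q ^ ((1 - (n : ℂ)) / 2 + (j : ℂ))) (a * q ^ (((n : ℂ) - 1) / 2)) p

/-- The cubic theta shifted factorial `⟨X, Y; q, p⟩_n` of a pair of nonzero numbers.  Write
`X = a z` and `Y = a / z`, that is `a = √(X Y)` and `z = X / a`; then
`⟨a z, a / z; q, p⟩_n = ∏_{j=0}^{n-1} γ(z q^((1-n)/2+j), a q^((n-1)/2); p)`.
The value does not depend on the choice of `(a, z)` or of `√q`: see `cubicFac_mul_div`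
and `cubicFac_eq_prod_of_sq_eq`. -/
def cubicFac (X Y q p : ℂ) (n : ℕ) : ℂ :=
  cubicFacAux ((X * Y) ^ (1 / 2 : ℂ)) (X / (X * Y) ^ (1 / 2 : ℂ)) q p n

theorem gamma_neg_neg (z a p : ℂ) : gamma (-z) (-a) p = gamma z a p := by
  unfold gamma
  refine tsum_congr fun kl => ?_
  obtain ⟨k, l⟩ := kl
  have e : (-1 : ℂ) ^ (k + l) * (-1 : ℂ) ^ (k - l) = 1 := by
    rw [← zpow_add₀ (by norm_num)]
    exact Even.neg_one_zpow ⟨k, by ring⟩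
  simp only
  rw [neg_eq_neg_one_mul a, neg_eq_neg_one_mul z, mul_zpow, mul_zpow]
  linear_combination (p ^ (k ^ 2 + k * l + l ^ 2) * a ^ (k + l) * z ^ (k - l)) * e

/-- The defining formula holds for every choice of `a` and `z`. -/
theorem cubicFac_mul_div {a z : ℂ} (ha : a ≠ 0) (hz : z ≠ 0) (q p : ℂ) (n : ℕ) :
    cubicFac (a * z) (a / z) q p n =
      ∏ j ∈ Finset.range n,
        gamma (z * q ^ ((1 - (n : ℂ)) / 2 + (j : ℂ))) (a * q ^ (((n : ℂ) - 1) / 2)) p := by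
  have h1 : a * z * (a / z) = a ^ 2 := by field_simp
  have h2 : ((a ^ 2) ^ (1 / 2 : ℂ)) ^ 2 = a ^ 2 := by
    have := Complex.cpow_nat_inv_pow (a ^ 2) (n := 2) (by norm_num)
    simpa only [Nat.cast_ofNat, one_div] using this
  unfold cubicFac cubicFacAux
  rw [h1]
  rcases sq_eq_sq_iff_eq_or_eq_neg.mp h2 with h | h
  · rw [h, mul_div_cancel_left₀ z ha]
  · have h3 : a * z / -a = -z := by field_simp
    rw [h, h3]
    refine Finset.prod_congr rfl fun j _ => ?_
    rw [neg_mul, neg_mul, gamma_neg_neg]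

/-- The value of `cubicFac` does not depend on the choice of the square root of `q`. -/
theorem cubicFac_eq_prod_of_sq_eq {a z q r : ℂ} (ha : a ≠ 0) (hz : z ≠ 0)
    (hr : r ^ 2 = q) (p : ℂ) (n : ℕ) :
    cubicFac (a * z) (a / z) q p n =
      ∏ j ∈ Finset.range n,
        gamma (z * r ^ (1 - (n : ℤ) + 2 * (j : ℤ))) (a * r ^ ((n : ℤ) - 1)) p := by
  rw [cubicFac_mul_div ha hz]
  refine Finset.prod_congr rfl fun j _ => ?_
  have hs : (q ^ (1 / 2 : ℂ)) ^ 2 = q := by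
    have := Complex.cpow_nat_inv_pow q (n := 2) (by norm_num)
    simpa only [Nat.cast_ofNat, one_div] using this
  have key : ∀ m : ℤ, q ^ ((m : ℂ) / 2) = (q ^ (1 / 2 : ℂ)) ^ m := fun m => by
    rw [← Complex.cpow_mul_int]
    congr 1
    ring
  have e1 : (1 - (n : ℂ)) / 2 + (j : ℂ) = ((1 - (n : ℤ) + 2 * (j : ℤ) : ℤ) : ℂ) / 2 := by
    push_cast
    ring
  have e2 : ((n : ℂ) - 1) / 2 = (((n : ℤ) - 1 : ℤ) : ℂ) / 2 := by
    push_cast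
    ring
  rw [e1, e2, key, key]
  rcases sq_eq_sq_iff_eq_or_eq_neg.mp (hs.trans hr.symm) with h | h
  · rw [h]
  · rw [h, neg_eq_neg_one_mul r, mul_zpow, mul_zpow]
    have e3 : (-1 : ℂ) ^ (1 - (n : ℤ) + 2 * (j : ℤ)) = (-1 : ℂ) ^ ((n : ℤ) - 1) := by
      have : 1 - (n : ℤ) + 2 * (j : ℤ) = ((n : ℤ) - 1) + 2 * (1 - (n : ℤ) + j) := by ring
      rw [this, zpow_add₀ (by norm_num), zpow_mul (-1 : ℂ) 2]
      norm_num
    rw [e3]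
    rcases Int.even_or_odd ((n : ℤ) - 1) with h' | h'
    · rw [h'.neg_one_zpow, one_mul, one_mul]
    · rw [h'.neg_one_zpow, neg_one_mul, neg_one_mul, mul_neg, mul_neg, gamma_neg_neg]

end CubicTheta

end

noncomputable section

namespace CubicTheta

open Filter Topology

/-! For fixed `a`, the function `z ↦ γ(z,a;p)` is a combination of two fixed functions, and
`θ(bz)θ(b/z)` is, up to a nonzero constant times `b`, the 2×2 determinant of these functions at `b`
and `z` (`ThetaBasis`). Both facts come from splitting a double series by parity, after the triple
product has turned theta products into series.

Linear algebra in this plane expresses `g(x)` through `g(b)` and `g(c)` for every `g` in it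
(`ThetaBasis.three_term`). Apply this to `g(y q^(k+m))` with nodes `d q^k` and `f q^m`, and iterate:
`∏_{j<n} g(y q^j)` becomes a sum over `k + m = n` of multiples of `∏_{j<k} g(d q^j) ∏_{j<m} g(f
q^j)` (`ThetaBasis.prod_expansion`). The coefficients are weighted counts of lattice paths; their
closed form satisfies the Pascal-type recursion because of Weierstrass' relation, itself the Plücker
relation between 2×2 determinants.

Now let `w² = q^(n-1)`, `g = γ(·,aw;p)`, `y = z/w`, `d = cw`, `f = 1/(bw)`. The coefficients become
very-well-poised (`poisedCoeff_eq`), and the products of `g` become cubic factorials; the quotient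
of two of them in the summand is the product over the nodes `f q^j`, since `γ(1/z,a) = γ(z,a)`. The
expansion needs generic `b`; continuity in `b` removes this restriction
(`ThetaBasis.poised_expansion`). -/

theorem hasSum_congr {ι : Type*} {f g : ι → ℂ} {s : ℂ} (h : ∀ i, f i = g i) :
    HasSum f s ↔ HasSum g s := by
  rw [funext h]

/-! ### Two-sided theta series. -/

/-- The triangular number `m (m - 1) / 2`. -/
def tri (m : ℤ) : ℤ := m * (m - 1) / 2

theorem two_mul_tri (m : ℤ) : 2 * tri m = m * (m - 1) :=
  Int.mul_ediv_cancel' (Int.even_mul_pred_self m).two_dvd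

theorem tri_add_one (m : ℤ) : tri (m + 1) = tri m + m := by
  have h1 := two_mul_tri m
  have h2 := two_mul_tri (m + 1)
  linarith

/-- The summand of the two-sided theta series. -/
def thetaTerm (q x : ℂ) (m : ℤ) : ℂ := q ^ tri m * x ^ m

/-- The two-sided theta series `∑ q^(m(m-1)/2) x^m`. -/
def thetaSeries (q x : ℂ) : ℂ := ∑' m : ℤ, thetaTerm q x m

theorem thetaTerm_ne_zero {q x : ℂ} (hq : q ≠ 0) (hx : x ≠ 0) (m : ℤ) : thetaTerm q x m ≠ 0 :=
  mul_ne_zero (zpow_ne_zero _ hq) (zpow_ne_zero _ hx)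

theorem thetaTerm_add_one {q x : ℂ} (hq : q ≠ 0) (hx : x ≠ 0) (m : ℤ) :
    thetaTerm q x (m + 1) = q ^ m * x * thetaTerm q x m := by
  unfold thetaTerm
  rw [tri_add_one, zpow_add₀ hq, zpow_add₀ hx, zpow_one]
  ring

/-- Ratio test on each half of `ℤ`: the successive ratios are `‖q‖ ^ n` times a constant, so they
tend to zero. -/
theorem summable_norm_thetaTerm {q x : ℂ} (hq : q ≠ 0) (hq1 : ‖q‖ < 1) (hx : x ≠ 0) :
    Summable fun m => ‖thetaTerm q x m‖ := by
  have hp : Tendsto (fun n : ℕ => ‖q‖ ^ n) atTop (𝓝 0) :=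
    tendsto_pow_atTop_nhds_zero_of_lt_one (norm_nonneg _) hq1
  refine Summable.of_nat_of_neg ?_ ?_
  · refine summable_of_ratio_test_tendsto_lt_one (l := 0) one_pos
      (Eventually.of_forall fun n => by simpa using thetaTerm_ne_zero hq hx n) ?_
    have h : ∀ n : ℕ, ‖‖thetaTerm q x ((n + 1 : ℕ) : ℤ)‖‖ / ‖‖thetaTerm q x (n : ℤ)‖‖
        = ‖q‖ ^ n * ‖x‖ := fun n => by
      have := norm_ne_zero_iff.mpr (thetaTerm_ne_zero hq hx n)
      rw [Nat.cast_succ, thetaTerm_add_one hq hx]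
      simp only [norm_mul, norm_norm, zpow_natCast, norm_pow]
      field_simp
    simp_rw [h]
    simpa using hp.mul_const ‖x‖
  · refine summable_of_ratio_test_tendsto_lt_one (l := 0) one_pos
      (Eventually.of_forall fun n => by simpa using thetaTerm_ne_zero hq hx (-n)) ?_
    have h : ∀ n : ℕ, ‖‖thetaTerm q x (-((n + 1 : ℕ) : ℤ))‖‖ / ‖‖thetaTerm q x (-(n : ℤ))‖‖
        = ‖q‖ ^ n * (‖q‖ * ‖x‖⁻¹) := fun n => by
      have h0 := norm_ne_zero_iff.mpr (thetaTerm_ne_zero hq hx (-((n + 1 : ℕ) : ℤ)))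
      have e : (-(n : ℤ)) = -((n + 1 : ℕ) : ℤ) + 1 := by push_cast; ring
      have hx' := norm_ne_zero_iff.mpr hx
      have hq' := norm_ne_zero_iff.mpr hq
      rw [e, thetaTerm_add_one hq hx]
      simp only [norm_mul, norm_norm, zpow_neg, norm_inv, zpow_natCast, norm_pow]
      field_simp
      ring
    simp_rw [h]
    simpa using hp.mul_const (‖q‖ * ‖x‖⁻¹)

theorem hasSum_thetaSeries {q x : ℂ} (hq : q ≠ 0) (hq1 : ‖q‖ < 1) (hx : x ≠ 0) :
    HasSum (thetaTerm q x) (thetaSeries q x) :=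
  (summable_norm_thetaTerm hq hq1 hx).of_norm.hasSum

theorem continuousAt_thetaSeries {q x : ℂ} (hq : q ≠ 0) (hq1 : ‖q‖ < 1) (hx : x ≠ 0) :
    ContinuousAt (thetaSeries q) x := by
  have hx' : 0 < ‖x‖ := norm_pos_iff.mpr hx
  have h2 : ((‖x‖ / 2 : ℝ) : ℂ) ≠ 0 := by simpa using hx
  have h3 : ((2 * ‖x‖ : ℝ) : ℂ) ≠ 0 := by simpa using hx
  -- On this annulus `‖y‖ ^ m` is bounded by its value at the outer radius if `m ≥ 0` and at the
  -- inner radius if `m ≤ 0`, so the sum of both values is a summable majorant.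
  let s : Set ℂ := {y | ‖x‖ / 2 < ‖y‖ ∧ ‖y‖ < 2 * ‖x‖}
  have hs : IsOpen s :=
    (isOpen_lt continuous_const continuous_norm).inter (isOpen_lt continuous_norm continuous_const)
  have hxs : x ∈ s := ⟨by linarith, by linarith⟩
  refine (continuousOn_tsum (s := s) (u := fun m => ‖thetaTerm q ((‖x‖ / 2 : ℝ) : ℂ) m‖
      + ‖thetaTerm q ((2 * ‖x‖ : ℝ) : ℂ) m‖) ?_
    ((summable_norm_thetaTerm hq hq1 h2).add (summable_norm_thetaTerm hq hq1 h3)) ?_).continuousAt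
    (hs.mem_nhds hxs)
  · intro m y hy
    have hy0 : y ≠ 0 := norm_pos_iff.mp (by have := hy.1; linarith)
    exact (continuousAt_const.mul (continuousAt_zpow₀ y m (Or.inl hy0))).continuousWithinAt
  · rintro m y ⟨hy1, hy2⟩
    have hn : ∀ t : ℝ, 0 < t → ‖thetaTerm q (t : ℂ) m‖ = ‖q‖ ^ tri m * t ^ m := fun t ht => by
      simp [thetaTerm, abs_of_pos ht]
    rw [hn _ (by positivity), hn _ (by positivity), ← mul_add]
    have : ‖thetaTerm q y m‖ = ‖q‖ ^ tri m * ‖y‖ ^ m := by simp [thetaTerm]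
    rw [this]
    refine mul_le_mul_of_nonneg_left ?_ (by positivity)
    rcases le_total 0 m with hm | hm
    · have := zpow_le_zpow_left₀ hm (norm_nonneg y) hy2.le
      have h4 : 0 ≤ (‖x‖ / 2) ^ m := by positivity
      linarith
    · have h5 : ‖y‖ ^ m ≤ (‖x‖ / 2) ^ m := by
        obtain ⟨k, rfl⟩ : ∃ k : ℕ, m = -(k : ℤ) := ⟨m.natAbs, by omega⟩
        rw [zpow_neg, zpow_neg, zpow_natCast, zpow_natCast]
        gcongr
      have h4 : 0 ≤ (2 * ‖x‖) ^ m := by positivity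
      linarith

theorem thetaSeries_eq_mul {q x : ℂ} (hq : q ≠ 0) (hx : x ≠ 0) :
    thetaSeries q x = x * thetaSeries q (q * x) := by
  unfold thetaSeries
  rw [← tsum_mul_left, ← (Equiv.addRight (1 : ℤ)).tsum_eq]
  refine tsum_congr fun m => ?_
  rw [Equiv.coe_addRight, thetaTerm_add_one hq hx]
  unfold thetaTerm
  rw [mul_zpow]
  ring

/-- A double sum over `ℤ × ℤ`, split according to the parity of the sum of the indices. -/
theorem hasSum_of_parity {f : ℤ × ℤ → ℂ} {s t : ℂ}
    (hs : HasSum (fun x : ℤ × ℤ => f (x.1 + x.2, x.1 - x.2)) s)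
    (ht : HasSum (fun x : ℤ × ℤ => f (x.1 + x.2 + 1, x.1 - x.2)) t) : HasSum f (s + t) := by
  have hinj : Function.Injective fun x : ℤ × ℤ => (x.1 + x.2, x.1 - x.2) := by
    rintro ⟨a, b⟩ ⟨c, d⟩ h
    simp only [Prod.mk.injEq] at h ⊢
    omega
  have hinj' : Function.Injective fun x : ℤ × ℤ => (x.1 + x.2 + 1, x.1 - x.2) := by
    rintro ⟨a, b⟩ ⟨c, d⟩ h
    simp only [Prod.mk.injEq] at h ⊢
    omega
  have hs' := (hinj.hasSum_range_iff (f := f)).mpr hs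
  have ht' := (hinj'.hasSum_range_iff (f := f)).mpr ht
  have hc : IsCompl (Set.range fun x : ℤ × ℤ => (x.1 + x.2, x.1 - x.2))
      (Set.range fun x : ℤ × ℤ => (x.1 + x.2 + 1, x.1 - x.2)) := by
    constructor
    · rw [Set.disjoint_left]
      rintro _ ⟨⟨a, b⟩, rfl⟩ ⟨⟨c, d⟩, h⟩
      simp only [Prod.mk.injEq] at h
      omega
    · rw [codisjoint_iff_le_sup]
      rintro ⟨k, l⟩ -
      rcases Int.even_or_odd (k + l) with ⟨i, hi⟩ | ⟨i, hi⟩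
      · exact Or.inl ⟨(i, i - l), by simp only [Prod.mk.injEq]; omega⟩
      · exact Or.inr ⟨(i, i - l), by simp only [Prod.mk.injEq]; omega⟩
  exact hs'.add_isCompl hc ht'

/-! ### Jacobi triple product, as the limit of its finite form. -/

/-- The product `(1 - p) (1 - p^2) ⋯ (1 - p^N)`. -/
def eulerProd (p : ℂ) (N : ℕ) : ℂ := ∏ j ∈ Finset.range N, (1 - p ^ (j + 1))

/-- The reciprocal of `eulerProd`, extended by zero to negative indices. -/
def eulerRecip (p : ℂ) (j : ℤ) : ℂ := if j < 0 then 0 else (eulerProd p j.toNat)⁻¹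

theorem one_sub_pow_ne_zero {p : ℂ} (hp : ‖p‖ < 1) (j : ℕ) : 1 - p ^ (j + 1) ≠ 0 := by
  intro h
  have h1 : ‖p ^ (j + 1)‖ = 1 := by rw [← sub_eq_zero.mp h, norm_one]
  rw [norm_pow] at h1
  exact (pow_lt_one₀ (norm_nonneg p) hp j.succ_ne_zero).ne h1

theorem eulerProd_ne_zero {p : ℂ} (hp : ‖p‖ < 1) (N : ℕ) : eulerProd p N ≠ 0 :=
  Finset.prod_ne_zero_iff.mpr fun j _ => one_sub_pow_ne_zero hp j

/-- Extension by zero makes this hold on all of `ℤ`: at `j = 0` the factor `1 - p ^ 0` vanishes. The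
Gaussian recursion below then needs no boundary cases. -/
theorem eulerRecip_sub_one {p : ℂ} (hp : ‖p‖ < 1) (j : ℤ) :
    eulerRecip p (j - 1) = (1 - p ^ j) * eulerRecip p j := by
  unfold eulerRecip
  rcases lt_trichotomy j 0 with h | rfl | h
  · rw [if_pos h, if_pos (by omega), mul_zero]
  · simp
  · obtain ⟨k, rfl⟩ : ∃ k : ℕ, j = (k + 1 : ℕ) := ⟨(j - 1).toNat, by omega⟩
    rw [if_neg (by omega), if_neg (by omega)]
    have e1 : (((k + 1 : ℕ) : ℤ) - 1).toNat = k := by omega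
    have e2 : ((k + 1 : ℕ) : ℤ).toNat = k + 1 := by omega
    rw [e1, e2, zpow_natCast]
    have h1 := one_sub_pow_ne_zero hp k
    have h2 := eulerProd_ne_zero hp k
    have h3 : eulerProd p (k + 1) = eulerProd p k * (1 - p ^ (k + 1)) :=
      Finset.prod_range_succ _ _
    rw [h3]
    field_simp

/-- The central Gaussian binomial coefficient `[2N, N + m]`. -/
def gaussCoeff (p : ℂ) (N : ℕ) (m : ℤ) : ℂ :=
  eulerProd p (2 * N) * (eulerRecip p (N + m) * eulerRecip p (N - m))

/-- This is the effect on coefficients of multiplying by `(1 - p^N x)(1 - p^(N+1)/x)`, which expands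
to `1 + p^(2N+1) - p^N x - p^(N+1)/x`. -/
theorem gaussCoeff_succ {p : ℂ} (hp0 : p ≠ 0) (hp : ‖p‖ < 1) (N : ℕ) (m : ℤ) :
    gaussCoeff p (N + 1) m = (1 + p ^ (2 * N + 1)) * gaussCoeff p N m
      + p ^ ((N : ℤ) + 1 - m) * gaussCoeff p N (m - 1)
      + p ^ ((N : ℤ) + 1 + m) * gaussCoeff p N (m + 1) := by
  unfold gaussCoeff
  have e1 : (N : ℤ) + m = (N + 1 + m) - 1 := by ring
  have e2 : (N : ℤ) - m = (N + 1 - m) - 1 := by ring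
  have e3 : (N : ℤ) + (m - 1) = (N + m) - 1 := by ring
  have e4 : (N : ℤ) - (m - 1) = N + 1 - m := by ring
  have e5 : (N : ℤ) + (m + 1) = N + 1 + m := by ring
  have e6 : (N : ℤ) - (m + 1) = (N - m) - 1 := by ring
  rw [e3, e4, e5, e6, eulerRecip_sub_one hp (N + m), eulerRecip_sub_one hp (N - m),
    e1, e2, eulerRecip_sub_one hp (N + 1 + m), eulerRecip_sub_one hp (N + 1 - m)]
  have h1 : eulerProd p (2 * (N + 1))
      = eulerProd p (2 * N) * (1 - p ^ (2 * N + 1)) * (1 - p ^ (2 * N + 2)) := by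
    rw [show 2 * (N + 1) = 2 * N + 1 + 1 by ring, eulerProd, Finset.prod_range_succ,
      Finset.prod_range_succ, eulerProd]
  rw [h1]
  have h2 : p ^ ((N : ℤ) + 1 + m - 1) = p ^ ((N : ℤ) + 1 + m) / p := zpow_sub_one₀ hp0 _
  have h3 : p ^ ((N : ℤ) + 1 - m - 1) = p ^ ((N : ℤ) + 1 - m) / p := zpow_sub_one₀ hp0 _
  rw [h2, h3]
  have h4 : p ^ (2 * N + 2) = p ^ ((N : ℤ) + 1 + m) * p ^ ((N : ℤ) + 1 - m) := by
    rw [← zpow_add₀ hp0, ← zpow_natCast]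
    congr 1
    push_cast
    ring
  have h5 : p ^ (2 * N + 1) = p ^ ((N : ℤ) + 1 + m) * p ^ ((N : ℤ) + 1 - m) / p := by
    rw [← h4, pow_succ p (2 * N + 1)]
    field_simp
  rw [h4, h5]
  push_cast
  field_simp
  ring

/-- The finite form of the Jacobi triple product identity. -/
theorem hasSum_finite_tripleProduct {p : ℂ} (hp0 : p ≠ 0) (hp : ‖p‖ < 1) {x : ℂ} (hx : x ≠ 0)
    (N : ℕ) :
    HasSum (fun m : ℤ => gaussCoeff p N m * thetaTerm p (-x) m)
      (∏ j ∈ Finset.range N, ((1 - p ^ j * x) * (1 - p ^ (j + 1) / x))) := by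
  induction N with
  | zero =>
    have h := hasSum_single (f := fun m : ℤ => gaussCoeff p 0 m * thetaTerm p (-x) m) 0 ?_
    · simpa [gaussCoeff, eulerRecip, eulerProd, thetaTerm, tri] using h
    · intro m hm
      rcases lt_or_gt_of_ne hm with h | h
      · simp [gaussCoeff, eulerRecip, h]
      · simp [gaussCoeff, eulerRecip, h]
  | succ N ih =>
    have hx' : -x ≠ 0 := neg_ne_zero.mpr hx
    rw [Finset.prod_range_succ]
    have h1 := ih.mul_left (1 + p ^ (2 * N + 1))
    -- Multiplication by `x` or `1/x` is absorbed by shifting the summation index by one.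
    have h2 := ((Equiv.subRight (1 : ℤ)).hasSum_iff.mpr ih).mul_left (p ^ N * -x)
    have h3 := ((Equiv.addRight (1 : ℤ)).hasSum_iff.mpr ih).mul_left (p ^ (N + 1) / -x)
    have hs := (h1.add h2).add h3
    have hval : (∏ j ∈ Finset.range N, ((1 - p ^ j * x) * (1 - p ^ (j + 1) / x)))
          * ((1 - p ^ N * x) * (1 - p ^ (N + 1) / x))
        = (1 + p ^ (2 * N + 1)) * (∏ j ∈ Finset.range N, ((1 - p ^ j * x) * (1 - p ^ (j + 1) / x)))
          + p ^ N * -x * (∏ j ∈ Finset.range N, ((1 - p ^ j * x) * (1 - p ^ (j + 1) / x)))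
          + p ^ (N + 1) / -x * (∏ j ∈ Finset.range N, ((1 - p ^ j * x) * (1 - p ^ (j + 1) / x))) := by
      generalize (∏ j ∈ Finset.range N, ((1 - p ^ j * x) * (1 - p ^ (j + 1) / x))) = F
      field_simp
      ring
    rw [hval]
    refine (hasSum_congr fun m => ?_).mpr hs
    · simp only [Function.comp_apply, Equiv.coe_addRight, Equiv.subRight_apply]
      rw [gaussCoeff_succ hp0 hp, thetaTerm_add_one hp0 hx']
      have h4 : thetaTerm p (-x) m = p ^ (m - 1) * -x * thetaTerm p (-x) (m - 1) := by
        rw [← thetaTerm_add_one hp0 hx', sub_add_cancel]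
      have h5 : p ^ ((N : ℤ) + 1 - m) * (p ^ (m - 1)) = p ^ N := by
        rw [← zpow_add₀ hp0, ← zpow_natCast]
        congr 1
        ring
      have h6 : p ^ ((N : ℤ) + 1 + m) = p ^ (N + 1) * p ^ m := by
        rw [zpow_add₀ hp0, ← zpow_natCast]
        push_cast
        rfl
      have h7 : p ^ (N + 1) / -x * (gaussCoeff p N (m + 1) * (p ^ m * -x * thetaTerm p (-x) m))
          = p ^ ((N : ℤ) + 1 + m) * gaussCoeff p N (m + 1) * thetaTerm p (-x) m := by
        rw [h6]
        field_simp
      rw [h7, ← h5]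
      linear_combination (p ^ ((N : ℤ) + 1 - m) * gaussCoeff p N (m - 1)) * h4

theorem summable_norm_neg_pow {p : ℂ} (hp : ‖p‖ < 1) (c : ℂ) :
    Summable fun j : ℕ => ‖-(p ^ j * c)‖ := by
  simp only [norm_neg, norm_mul, norm_pow]
  exact (summable_geometric_of_lt_one (norm_nonneg p) hp).mul_right _

theorem multipliable_one_sub_pow_mul {p : ℂ} (hp : ‖p‖ < 1) (c : ℂ) :
    Multipliable fun j : ℕ => (1 - p ^ j * c) := by
  simpa [sub_eq_add_neg] using multipliable_one_add_of_summable (summable_norm_neg_pow hp c)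

theorem tprod_one_sub_pow_mul_ne_zero {p : ℂ} (hp : ‖p‖ < 1) {c : ℂ}
    (hc : ∀ j : ℕ, 1 - p ^ j * c ≠ 0) : ∏' j : ℕ, (1 - p ^ j * c) ≠ 0 := by
  have := tprod_one_add_ne_zero_of_summable (f := fun j : ℕ => -(p ^ j * c))
    (fun j => by simpa [sub_eq_add_neg] using hc j) (summable_norm_neg_pow hp c)
  simpa [sub_eq_add_neg] using this

theorem multipliable_theta {p : ℂ} (hp : ‖p‖ < 1) (x : ℂ) :
    Multipliable fun j : ℕ => (1 - p ^ j * x) * (1 - p ^ (j + 1) / x) := by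
  refine (multipliable_one_sub_pow_mul hp x).mul ?_
  simpa [pow_succ, mul_div_assoc] using multipliable_one_sub_pow_mul hp (p / x)

theorem theta_eq_mul {p : ℂ} (hp : ‖p‖ < 1) (x : ℂ) :
    theta x p = (∏' j : ℕ, (1 - p ^ j * x)) * ∏' j : ℕ, (1 - p ^ j * (p / x)) := by
  rw [← (multipliable_one_sub_pow_mul hp x).tprod_mul (multipliable_one_sub_pow_mul hp (p / x))]
  refine tprod_congr fun j => ?_
  rw [pow_succ, mul_div_assoc]

/-- The Jacobi triple product identity. -/
theorem exists_tripleProduct {p : ℂ} (hp0 : p ≠ 0) (hp : ‖p‖ < 1) :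
    ∃ P : ℂ, P ≠ 0 ∧ ∀ x : ℂ, x ≠ 0 → theta x p = P * thetaSeries p (-x) := by
  have hmul : Multipliable fun j : ℕ => (1 - p ^ (j + 1)) := by
    simpa [pow_succ] using multipliable_one_sub_pow_mul hp p
  have hP : ∏' j : ℕ, (1 - p ^ (j + 1)) ≠ 0 := by
    simpa [pow_succ] using tprod_one_sub_pow_mul_ne_zero hp (c := p)
      (fun j => by simpa [pow_succ] using one_sub_pow_ne_zero hp j)
  set P := ∏' j : ℕ, (1 - p ^ (j + 1))
  have hlim : Tendsto (eulerProd p) atTop (𝓝 P) := hmul.tendsto_prod_tprod_nat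
  have hlim' : Tendsto (fun n => (eulerProd p n)⁻¹) atTop (𝓝 P⁻¹) := hlim.inv₀ hP
  obtain ⟨M, hM⟩ := (Metric.isBounded_range_of_tendsto _ hlim).exists_norm_le
  obtain ⟨M', hM'⟩ := (Metric.isBounded_range_of_tendsto _ hlim').exists_norm_le
  have hM0 : 0 ≤ M := (norm_nonneg _).trans (hM _ ⟨0, rfl⟩)
  have hM'0 : 0 ≤ M' := (norm_nonneg _).trans (hM' _ ⟨0, rfl⟩)
  have hR : ∀ j, ‖eulerRecip p j‖ ≤ M' := fun j => by
    unfold eulerRecip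
    split_ifs
    · simpa using hM'0
    · exact hM' _ ⟨_, rfl⟩
  have hRlim : ∀ u : ℕ → ℤ, Tendsto u atTop atTop →
      Tendsto (fun N => eulerRecip p (u N)) atTop (𝓝 P⁻¹) := fun u hu => by
    have h1 : Tendsto (fun N => (u N).toNat) atTop atTop := by
      refine tendsto_atTop.mpr fun b => ?_
      filter_upwards [hu.eventually_ge_atTop (b : ℤ)] with N hN
      omega
    refine (hlim'.comp h1).congr' ?_
    filter_upwards [hu.eventually_ge_atTop 0] with N hN
    simp [eulerRecip, not_lt.mpr hN]
  refine ⟨P⁻¹, inv_ne_zero hP, fun x hx => ?_⟩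
  have hx' : -x ≠ 0 := neg_ne_zero.mpr hx
  have hsum : Tendsto (fun N => ∑' m, gaussCoeff p N m * thetaTerm p (-x) m) atTop
      (𝓝 (∑' m, P⁻¹ * thetaTerm p (-x) m)) := by
    -- Each Gaussian coefficient tends to `P * (P⁻¹ * P⁻¹) = P⁻¹`, and all are bounded uniformly in
    -- `N` and `m`.
    refine tendsto_tsum_of_dominated_convergence
      (bound := fun m => M * (M' * M') * ‖thetaTerm p (-x) m‖)
      ((summable_norm_thetaTerm hp0 hp hx').mul_left _) (fun m => ?_)
      (Eventually.of_forall fun N m => ?_)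
    · refine Tendsto.mul_const _ ?_
      have h2 : Tendsto (fun N : ℕ => 2 * N) atTop atTop :=
        tendsto_id.const_mul_atTop' two_pos
      have h3 := (hlim.comp h2).mul ((hRlim (fun N : ℕ => (N : ℤ) + m)
        (tendsto_atTop_add_const_right _ _ tendsto_natCast_atTop_atTop)).mul
        (hRlim (fun N : ℕ => (N : ℤ) - m)
        (tendsto_atTop_add_const_right _ (-m) tendsto_natCast_atTop_atTop)))
      rw [mul_inv_cancel_left₀ hP] at h3
      exact h3
    · rw [norm_mul]
      refine mul_le_mul_of_nonneg_right ?_ (norm_nonneg _)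
      unfold gaussCoeff
      rw [norm_mul, norm_mul]
      exact mul_le_mul (hM _ ⟨_, rfl⟩) (mul_le_mul (hR _) (hR _) (norm_nonneg _) hM'0)
        (by positivity) hM0
  simp_rw [(hasSum_finite_tripleProduct hp0 hp hx _).tsum_eq] at hsum
  rw [tsum_mul_left] at hsum
  exact tendsto_nhds_unique (multipliable_theta hp x).tendsto_prod_tprod_nat hsum

/-! ### Inversion, zeros and continuity of theta. -/

theorem tprod_one_sub_pow_mul_eq {p : ℂ} (hp : ‖p‖ < 1) (c : ℂ) :
    ∏' j : ℕ, (1 - p ^ j * c) = (1 - c) * ∏' j : ℕ, (1 - p ^ j * (p * c)) := by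
  have h1 : ∀ j : ℕ, 1 - p ^ (j + 1) * c = 1 - p ^ j * (p * c) := fun j => by ring
  have h : Multipliable fun j : ℕ => (1 - p ^ (j + 1) * c) := by
    simp_rw [h1]
    exact multipliable_one_sub_pow_mul hp (p * c)
  have h2 := tprod_eq_zero_mul' (f := fun j : ℕ => 1 - p ^ j * c) h
  simp_rw [h1] at h2
  rw [h2, pow_zero, one_mul]

theorem theta_eq_one_sub_mul {p : ℂ} (hp : ‖p‖ < 1) (x : ℂ) :
    theta x p = (1 - x) * ((∏' j : ℕ, (1 - p ^ j * (p * x))) * ∏' j : ℕ, (1 - p ^ j * (p / x))) := by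
  rw [theta_eq_mul hp, tprod_one_sub_pow_mul_eq hp, mul_assoc]

/-- Without its factor `1 - x`, the product is symmetric under `x ↔ 1/x`. -/
theorem theta_inv {p : ℂ} (hp : ‖p‖ < 1) {x : ℂ} (hx : x ≠ 0) :
    theta x⁻¹ p = -(theta x p / x) := by
  rw [theta_eq_one_sub_mul hp, theta_eq_one_sub_mul hp, div_inv_eq_mul, ← div_eq_mul_inv p x]
  generalize (∏' j : ℕ, (1 - p ^ j * (p * x))) = A
  generalize (∏' j : ℕ, (1 - p ^ j * (p / x))) = B
  field_simp
  ring

/-- A convergent product vanishes only if some factor does, so every zero is a power of `p`.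
Countability suffices for the density argument in `dense_generic`. -/
theorem countable_theta_eq_zero {p : ℂ} (hp : ‖p‖ < 1) :
    {x : ℂ | x ≠ 0 ∧ theta x p = 0}.Countable := by
  refine ((Set.countable_range fun j : ℕ => (p ^ j)⁻¹).union
    (Set.countable_range fun j : ℕ => p ^ (j + 1))).mono ?_
  rintro x ⟨hx, h⟩
  rw [theta_eq_mul hp, mul_eq_zero] at h
  rcases h with h | h
  · refine Or.inl ?_
    by_contra hn
    refine tprod_one_sub_pow_mul_ne_zero hp (fun j hj => hn ⟨j, ?_⟩) h
    exact inv_eq_of_mul_eq_one_right (sub_eq_zero.mp hj).symm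
  · refine Or.inr ?_
    by_contra hn
    refine tprod_one_sub_pow_mul_ne_zero hp (fun j hj => hn ⟨j, ?_⟩) h
    have h1 := sub_eq_zero.mp hj
    rw [← mul_div_assoc, ← pow_succ, eq_div_iff hx, one_mul] at h1
    exact h1.symm

theorem theta_zero_right (x : ℂ) : theta x 0 = 1 - x := by
  simp [theta_eq_one_sub_mul (p := 0) (by simp)]

theorem continuousAt_theta {p : ℂ} (hp : ‖p‖ < 1) {x : ℂ} (hx : x ≠ 0) :
    ContinuousAt (fun y => theta y p) x := by
  by_cases hp0 : p = 0
  · subst hp0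
    simp_rw [theta_zero_right]
    fun_prop
  · obtain ⟨P, -, h⟩ := exists_tripleProduct hp0 hp
    have h1 : ContinuousAt (fun y => P * thetaSeries p (-y)) x :=
      continuousAt_const.mul (ContinuousAt.comp (f := fun y : ℂ => -y)
        (continuousAt_thetaSeries hp0 hp (neg_ne_zero.mpr hx)) continuousAt_neg)
    refine h1.congr ?_
    filter_upwards [isOpen_ne.mem_nhds hx] with y hy
    exact (h y hy).symm

/-! ### The plane of symmetric theta functions of degree two. -/

theorem hasSum_thetaTerm_mul {q r x y : ℂ} (hq : q ≠ 0) (hq1 : ‖q‖ < 1) (hr : r ≠ 0)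
    (hr1 : ‖r‖ < 1) (hx : x ≠ 0) (hy : y ≠ 0) :
    HasSum (fun m : ℤ × ℤ => thetaTerm q x m.1 * thetaTerm r y m.2)
      (thetaSeries q x * thetaSeries r y) :=
  (hasSum_thetaSeries hq hq1 hx).mul (hasSum_thetaSeries hr hr1 hy)
    (summable_mul_of_summable_norm (summable_norm_thetaTerm hq hq1 hx)
      (summable_norm_thetaTerm hr hr1 hy))

/-- Two functions that span the symmetric theta functions of degree two with nome `p`, and the
expansions of `θ(bz) θ(b/z)` and of the cubic theta function in terms of them. -/
structure ThetaBasis (p : ℂ) where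
  (even odd : ℂ → ℂ)
  const : ℂ
  const_ne_zero : const ≠ 0
  continuousAt_even : ∀ {z : ℂ}, z ≠ 0 → ContinuousAt even z
  continuousAt_odd : ∀ {z : ℂ}, z ≠ 0 → ContinuousAt odd z
  theta_mul_theta : ∀ {b z : ℂ}, b ≠ 0 → z ≠ 0 →
    theta (b * z) p * theta (b / z) p = const * b * (odd b * even z - even b * odd z)
  gamma_eq : ∀ {a : ℂ}, a ≠ 0 → ∃ s t : ℂ, ∀ z : ℂ, z ≠ 0 →
    gamma z a p = s * even z + t * odd z

theorem gamma_zero_right (z a : ℂ) : gamma z a 0 = 1 := by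
  unfold gamma
  rw [tsum_eq_single 0]
  · simp
  · rintro ⟨k, l⟩ h
    have h1 : k ^ 2 + k * l + l ^ 2 ≠ 0 := fun h0 => h <| by
      have h2 : (2 * k + l) ^ 2 + 3 * l ^ 2 = 0 := by linear_combination 4 * h0
      have hl : l = 0 := by nlinarith [sq_nonneg (2 * k + l), sq_nonneg l]
      have hk : k = 0 := by subst hl; nlinarith
      simp [hk, hl]
    simp [zero_zpow _ h1]

/-- The nome `0` is separate: the series construction below relies on power laws for `p ≠ 0`, and
its odd function would degenerate to `z` instead of `z + 1/z`. -/
theorem nonempty_thetaBasis_zero : Nonempty (ThetaBasis 0) :=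
  ⟨{  even := fun _ => 1
      odd := fun z => z + z⁻¹
      const := 1
      const_ne_zero := one_ne_zero
      continuousAt_even := fun _ => continuousAt_const
      continuousAt_odd := fun hz => continuousAt_id.add (continuousAt_inv₀ hz)
      theta_mul_theta := fun hb hz => by
        simp only [theta_zero_right]
        field_simp
        ring
      gamma_eq := fun _ => ⟨1, 0, fun z _ => by simp [gamma_zero_right]⟩ }⟩

theorem norm_pow_lt_one {p : ℂ} (hp : ‖p‖ < 1) {k : ℕ} (hk : k ≠ 0) : ‖p ^ k‖ < 1 := by
  rw [norm_pow]
  exact pow_lt_one₀ (norm_nonneg p) hp hk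

theorem thetaSeries_mul_thetaSeries {p : ℂ} (hp0 : p ≠ 0) (hp : ‖p‖ < 1) {b z : ℂ} (hb : b ≠ 0)
    (hz : z ≠ 0) :
    thetaSeries p (-(b * z)) * thetaSeries p (-(b / z)) =
      thetaSeries (p ^ 2) (b ^ 2) * thetaSeries (p ^ 2) (p * z ^ 2)
      + -(b * z) * (thetaSeries (p ^ 2) (p * b ^ 2) * thetaSeries (p ^ 2) (p ^ 2 * z ^ 2)) := by
  have hq := pow_ne_zero 2 hp0
  have hq1 := norm_pow_lt_one hp two_ne_zero
  refine (hasSum_thetaTerm_mul hp0 hp hp0 hp (neg_ne_zero.mpr (mul_ne_zero hb hz))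
    (neg_ne_zero.mpr (div_ne_zero hb hz))).unique (hasSum_of_parity ?_ ?_)
  · refine (hasSum_congr fun x => ?_).mpr (hasSum_thetaTerm_mul hq hq1 hq hq1
      (pow_ne_zero 2 hb) (mul_ne_zero hp0 (pow_ne_zero 2 hz)))
    obtain ⟨i, j⟩ := x
    simp only [thetaTerm]
    have e : tri (i + j) + tri (i - j) = 2 * tri i + (2 * tri j + j) := by
      have := two_mul_tri (i + j)
      have := two_mul_tri (i - j)
      have := two_mul_tri i
      have := two_mul_tri j
      nlinarith
    have e1 : p ^ tri (i + j) * p ^ tri (i - j) = (p ^ 2) ^ tri i * ((p ^ 2) ^ tri j * p ^ j) := by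
      rw [← zpow_add₀ hp0, e, zpow_add₀ hp0, zpow_add₀ hp0, zpow_mul, zpow_mul]
      rfl
    have e2 : (-(b * z)) ^ (i + j) * (-(b / z)) ^ (i - j) = (b ^ 2) ^ i * (z ^ 2) ^ j := by
      have hA : -(b * z) ≠ 0 := neg_ne_zero.mpr (mul_ne_zero hb hz)
      have hB : -(b / z) ≠ 0 := neg_ne_zero.mpr (div_ne_zero hb hz)
      have h1 : b ^ 2 = -(b * z) * -(b / z) := by field_simp
      have h2 : z ^ 2 = -(b * z) / -(b / z) := by field_simp
      rw [h1, h2, zpow_add₀ hA, zpow_sub₀ hB, mul_zpow, div_zpow]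
      ring
    rw [mul_zpow]
    linear_combination (-(b * z)) ^ (i + j) * (-(b / z)) ^ (i - j) * e1
      + (p ^ 2) ^ tri i * ((p ^ 2) ^ tri j * p ^ j) * e2
  · refine (hasSum_congr fun x => ?_).mpr ((hasSum_thetaTerm_mul hq hq1 hq hq1
      (mul_ne_zero hp0 (pow_ne_zero 2 hb)) (mul_ne_zero hq (pow_ne_zero 2 hz))).mul_left (-(b * z)))
    obtain ⟨i, j⟩ := x
    simp only [thetaTerm]
    have e : tri (i + j + 1) + tri (i - j) = 2 * tri i + i + (2 * tri j + 2 * j) := by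
      have := two_mul_tri (i + j + 1)
      have := two_mul_tri (i - j)
      have := two_mul_tri i
      have := two_mul_tri j
      nlinarith
    have e1 : p ^ tri (i + j + 1) * p ^ tri (i - j)
        = (p ^ 2) ^ tri i * p ^ i * ((p ^ 2) ^ tri j * (p ^ 2) ^ j) := by
      rw [← zpow_add₀ hp0, e, zpow_add₀ hp0, zpow_add₀ hp0, zpow_add₀ hp0, zpow_mul, zpow_mul,
        zpow_mul]
      rfl
    have e2 : (-(b * z)) ^ (i + j + 1) * (-(b / z)) ^ (i - j)
        = -(b * z) * ((b ^ 2) ^ i * (z ^ 2) ^ j) := by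
      have hA : -(b * z) ≠ 0 := neg_ne_zero.mpr (mul_ne_zero hb hz)
      have hB : -(b / z) ≠ 0 := neg_ne_zero.mpr (div_ne_zero hb hz)
      have h1 : b ^ 2 = -(b * z) * -(b / z) := by field_simp
      have h2 : z ^ 2 = -(b * z) / -(b / z) := by field_simp
      rw [h1, h2, zpow_add₀ hA, zpow_add₀ hA, zpow_sub₀ hB, mul_zpow (-(b * z)), div_zpow,
        zpow_one]
      ring
    rw [mul_zpow, mul_zpow (p ^ 2)]
    linear_combination (-(b * z)) ^ (i + j + 1) * (-(b / z)) ^ (i - j) * e1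
      + (p ^ 2) ^ tri i * p ^ i * ((p ^ 2) ^ tri j * (p ^ 2) ^ j) * e2

/-- Since `k² + kl + l² = (3(k+l)² + (k-l)²)/4`, the sum and difference of the indices separate the
variables. They have equal parity, which gives one product of series for each parity, with nomes `p
^ 6` and `p ^ 2`. -/
theorem gamma_eq_thetaSeries {p : ℂ} (hp0 : p ≠ 0) (hp : ‖p‖ < 1) {a z : ℂ} (ha : a ≠ 0)
    (hz : z ≠ 0) :
    gamma z a p = thetaSeries (p ^ 6) (p ^ 3 * a ^ 2) * thetaSeries (p ^ 2) (p * z ^ 2)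
      + p * a * z * (thetaSeries (p ^ 6) (p ^ 6 * a ^ 2) * thetaSeries (p ^ 2) (p ^ 2 * z ^ 2)) := by
  have hq := pow_ne_zero 2 hp0
  have hq1 := norm_pow_lt_one hp two_ne_zero
  have hr := pow_ne_zero 6 hp0
  have hr1 := norm_pow_lt_one hp (k := 6) (by norm_num)
  have ha2 := pow_ne_zero 2 ha
  have hz2 := pow_ne_zero 2 hz
  unfold gamma
  refine HasSum.tsum_eq (hasSum_of_parity ?_ ?_)
  · refine (hasSum_congr fun x => ?_).mpr (hasSum_thetaTerm_mul hr hr1 hq hq1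
      (mul_ne_zero (pow_ne_zero 3 hp0) ha2) (mul_ne_zero hp0 hz2))
    obtain ⟨i, j⟩ := x
    simp only [thetaTerm]
    have e : (i + j) ^ 2 + (i + j) * (i - j) + (i - j) ^ 2
        = 6 * tri i + 3 * i + (2 * tri j + j) := by
      have := two_mul_tri i
      have := two_mul_tri j
      linarith
    have e1 : p ^ ((i + j) ^ 2 + (i + j) * (i - j) + (i - j) ^ 2)
        = (p ^ 6) ^ tri i * (p ^ 3) ^ i * ((p ^ 2) ^ tri j * p ^ j) := by
      rw [e, zpow_add₀ hp0, zpow_add₀ hp0, zpow_add₀ hp0, zpow_mul, zpow_mul, zpow_mul]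
      rfl
    rw [e1, show i + j + (i - j) = 2 * i by ring, show i + j - (i - j) = 2 * j by ring,
      zpow_mul a, zpow_mul z, mul_zpow, mul_zpow]
    simp only [zpow_ofNat]
    ring
  · refine (hasSum_congr fun x => ?_).mpr ((hasSum_thetaTerm_mul hr hr1 hq hq1
      (mul_ne_zero hr ha2) (mul_ne_zero hq hz2)).mul_left (p * a * z))
    obtain ⟨i, j⟩ := x
    simp only [thetaTerm]
    have e : (i + j + 1) ^ 2 + (i + j + 1) * (i - j) + (i - j) ^ 2
        = 6 * tri i + 6 * i + (2 * tri j + 2 * j) + 1 := by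
      have := two_mul_tri i
      have := two_mul_tri j
      linarith
    have e1 : p ^ ((i + j + 1) ^ 2 + (i + j + 1) * (i - j) + (i - j) ^ 2)
        = (p ^ 6) ^ tri i * (p ^ 6) ^ i * ((p ^ 2) ^ tri j * (p ^ 2) ^ j) * p := by
      rw [e, zpow_add₀ hp0, zpow_add₀ hp0, zpow_add₀ hp0, zpow_add₀ hp0, zpow_mul, zpow_mul,
        zpow_mul, zpow_mul, zpow_one]
      rfl
    rw [e1, show i + j + 1 + (i - j) = 2 * i + 1 by ring,
      show i + j + 1 - (i - j) = 2 * j + 1 by ring,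
      zpow_add₀ ha, zpow_add₀ hz, zpow_mul a, zpow_mul z, mul_zpow, mul_zpow (p ^ 2)]
    simp only [zpow_ofNat]
    ring

theorem nonempty_thetaBasis {p : ℂ} (hp : ‖p‖ < 1) : Nonempty (ThetaBasis p) := by
  by_cases hp0 : p = 0
  · subst hp0
    exact nonempty_thetaBasis_zero
  obtain ⟨P, hP, hθ⟩ := exists_tripleProduct hp0 hp
  have hq := pow_ne_zero 2 hp0
  have hq1 := norm_pow_lt_one hp two_ne_zero
  refine ⟨{ even := fun z => thetaSeries (p ^ 2) (p * z ^ 2)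
            odd := fun z => z * thetaSeries (p ^ 2) (p ^ 2 * z ^ 2)
            const := P ^ 2
            const_ne_zero := pow_ne_zero 2 hP
            continuousAt_even := fun {z} hz => ?_
            continuousAt_odd := fun {z} hz => ?_
            theta_mul_theta := fun {b z} hb hz => ?_
            gamma_eq := fun {a} ha => ⟨thetaSeries (p ^ 6) (p ^ 3 * a ^ 2),
              p * a * thetaSeries (p ^ 6) (p ^ 6 * a ^ 2), fun z hz => ?_⟩ }⟩
  · exact ContinuousAt.comp (f := fun z : ℂ => p * z ^ 2)
      (continuousAt_thetaSeries hq hq1 (mul_ne_zero hp0 (pow_ne_zero 2 hz))) (by fun_prop)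
  · exact continuousAt_id.mul (ContinuousAt.comp (f := fun z : ℂ => p ^ 2 * z ^ 2)
      (continuousAt_thetaSeries hq hq1 (mul_ne_zero hq (pow_ne_zero 2 hz))) (by fun_prop))
  · rw [hθ _ (mul_ne_zero hb hz), hθ _ (div_ne_zero hb hz)]
    have h1 := thetaSeries_mul_thetaSeries hp0 hp hb hz
    -- This turns the series in `b ^ 2` into `b` times the odd function at `b`, so that a
    -- determinant appears.
    have h2 := thetaSeries_eq_mul hq (pow_ne_zero 2 hb)
    rw [h2] at h1
    linear_combination P ^ 2 * h1
  · rw [gamma_eq_thetaSeries hp0 hp ha hz]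
    ring

/-! ### Three-term relations. -/

/-- Weierstrass' three-term relation. -/
theorem theta_weierstrass {p : ℂ} (hp : ‖p‖ < 1) {x y u v : ℂ} (hx : x ≠ 0) (hy : y ≠ 0)
    (hu : u ≠ 0) (hv : v ≠ 0) :
    theta (x * y) p * theta (x / y) p * (theta (u * v) p * theta (u / v) p)
      - theta (x * v) p * theta (x / v) p * (theta (u * y) p * theta (u / y) p)
      = u / y * (theta (y * v) p * theta (y / v) p * (theta (x * u) p * theta (x / u) p)) := by
  obtain ⟨T⟩ := nonempty_thetaBasis hp
  rw [T.theta_mul_theta hx hy, T.theta_mul_theta hu hv, T.theta_mul_theta hx hv,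
    T.theta_mul_theta hu hy, T.theta_mul_theta hy hv, T.theta_mul_theta hx hu]
  field_simp
  ring

/-- A form of Weierstrass' relation that does not involve square roots. -/
theorem theta_weierstrass' {p : ℂ} (hp : ‖p‖ < 1) {s t u v : ℂ} (hs : s ≠ 0) (ht : t ≠ 0)
    (hu : u ≠ 0) (hv : v ≠ 0) :
    theta (u * v) p * theta (s * u * v) p * theta (t * u * v) p * theta (s * u / (t * v)) p
      = theta u p * theta (s * u) p * theta (t * u * v ^ 2) p * theta (s * u / t) p
        + u * (theta v p * theta (s * u ^ 2 * v) p * theta (t * v) p * theta (s / (t * v)) p) := by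
  -- The substitution into the symmetric form involves square roots of `s` and `t`; they enter the
  -- resulting theta arguments only through their squares.
  obtain ⟨σ, rfl⟩ := IsAlgClosed.exists_pow_nat_eq s two_pos
  obtain ⟨τ, rfl⟩ := IsAlgClosed.exists_pow_nat_eq t two_pos
  have hσ : σ ≠ 0 := by rintro rfl; simp at hs
  have hτ : τ ≠ 0 := by rintro rfl; simp at ht
  have h := theta_weierstrass hp (x := σ * τ * u * v) (y := τ / σ) (u := u * σ / τ)
    (v := v * τ / σ) (by positivity) (by positivity) (by positivity) (by positivity)
  have e1 : σ * τ * u * v * (τ / σ) = τ ^ 2 * u * v := by field_simp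
  have e2 : σ * τ * u * v / (τ / σ) = σ ^ 2 * u * v := by field_simp
  have e3 : u * σ / τ * (v * τ / σ) = u * v := by field_simp
  have e4 : u * σ / τ / (v * τ / σ) = σ ^ 2 * u / (τ ^ 2 * v) := by field_simp
  have e5 : σ * τ * u * v * (v * τ / σ) = τ ^ 2 * u * v ^ 2 := by field_simp
  have e6 : σ * τ * u * v / (v * τ / σ) = σ ^ 2 * u := by field_simp
  have e7 : u * σ / τ * (τ / σ) = u := by field_simp
  have e8 : u * σ / τ / (τ / σ) = σ ^ 2 * u / τ ^ 2 := by field_simp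
  have e9 : τ / σ * (v * τ / σ) = (σ ^ 2 / (τ ^ 2 * v))⁻¹ := by field_simp
  have e10 : τ / σ / (v * τ / σ) = v⁻¹ := by field_simp
  have e11 : σ * τ * u * v * (u * σ / τ) = σ ^ 2 * u ^ 2 * v := by field_simp
  have e12 : σ * τ * u * v / (u * σ / τ) = τ ^ 2 * v := by field_simp
  rw [e1, e2, e3, e4, e5, e6, e7, e8, e9, e10, e11, e12, theta_inv hp (by positivity),
    theta_inv hp hv] at h
  have e13 : σ ^ 2 * u / τ ^ 2 * (-(theta (σ ^ 2 / (τ ^ 2 * v)) p / (σ ^ 2 / (τ ^ 2 * v)))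
      * -(theta v p / v) * (theta (σ ^ 2 * u ^ 2 * v) p * theta (τ ^ 2 * v) p))
      = u * (theta v p * theta (σ ^ 2 * u ^ 2 * v) p * theta (τ ^ 2 * v) p
        * theta (σ ^ 2 / (τ ^ 2 * v)) p) := by
    field_simp
  rw [e13] at h
  linear_combination h

/-- The three-term relation for a symmetric theta function of degree two. -/
theorem ThetaBasis.three_term {p : ℂ} (T : ThetaBasis p) {s t : ℂ} {g : ℂ → ℂ}
    (hg : ∀ z, z ≠ 0 → g z = s * T.even z + t * T.odd z) {b c x : ℂ} (hb : b ≠ 0) (hc : c ≠ 0)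
    (hx : x ≠ 0) :
    theta (c * b) p * theta (c / b) p * g x =
      theta (c * x) p * theta (c / x) p * g b - c / b * (theta (b * x) p * theta (b / x) p) * g c := by
  rw [T.theta_mul_theta hc hb, T.theta_mul_theta hc hx, T.theta_mul_theta hb hx, hg x hx, hg b hb,
    hg c hc]
  field_simp
  ring

/-! ### Lattice-path expansion of products. -/

/-- `K k m` is the total weight of lattice paths from `(0, 0)` to `(k, m)` whose steps in the two
directions have weights `A` and `B`; each factor `X` lengthens the paths by one step. -/
theorem prod_eq_sum_antidiagonal {R : Type*} [CommRing R] (X : ℕ → R) (M K A B : ℕ → ℕ → R)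
    (N : ℕ) (h00 : K 0 0 * M 0 0 = 1)
    (hM : ∀ k m, k + m < N → X (k + m) * M k m = A k m * M (k + 1) m + B k m * M k (m + 1))
    (hK0 : ∀ m < N, K 0 (m + 1) = B 0 m * K 0 m) (hK1 : ∀ k < N, K (k + 1) 0 = A k 0 * K k 0)
    (hK : ∀ k m, k + m + 1 < N →
      K (k + 1) (m + 1) = A k (m + 1) * K k (m + 1) + B (k + 1) m * K (k + 1) m) :
    ∀ n ≤ N, ∏ j ∈ Finset.range n, X j =
      ∑ x ∈ Finset.HasAntidiagonal.antidiagonal n, K x.1 x.2 * M x.1 x.2 := by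
  -- `U` and `V` collect the paths whose last step raises `k`, respectively `m`; on the axes one of
  -- them is zero.
  let U : ℕ → ℕ → R := fun k m => match k with
    | 0 => 0
    | k + 1 => A k m * K k m
  let V : ℕ → ℕ → R := fun k m => match m with
    | 0 => 0
    | m + 1 => B k m * K k m
  have hUV : ∀ k m, 0 < k + m → k + m ≤ N → K k m = U k m + V k m := by
    rintro (_ | k) (_ | m) h1 h2
    · omega
    · simpa [U, V] using hK0 m (by omega)
    · simpa [U, V] using hK1 k (by omega)
    · exact hK k m (by omega)
  intro n
  induction n with
  | zero => intro _; simp [h00]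
  | succ n ih =>
    intro hn
    have h1 : ∑ x ∈ Finset.HasAntidiagonal.antidiagonal (n + 1), K x.1 x.2 * M x.1 x.2
        = ∑ x ∈ Finset.HasAntidiagonal.antidiagonal (n + 1), U x.1 x.2 * M x.1 x.2
          + ∑ x ∈ Finset.HasAntidiagonal.antidiagonal (n + 1), V x.1 x.2 * M x.1 x.2 := by
      rw [← Finset.sum_add_distrib]
      refine Finset.sum_congr rfl fun x hx => ?_
      have := Finset.HasAntidiagonal.mem_antidiagonal.mp hx
      rw [hUV x.1 x.2 (by omega) (by omega), add_mul]
    rw [Finset.prod_range_succ, ih (by omega), h1, Finset.Nat.sum_antidiagonal_succ,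
      Finset.Nat.sum_antidiagonal_succ' (n := n), Finset.sum_mul]
    simp only [U, V, zero_mul, zero_add]
    rw [← Finset.sum_add_distrib]
    refine Finset.sum_congr rfl fun x hx => ?_
    have hx' := Finset.HasAntidiagonal.mem_antidiagonal.mp hx
    have h2 := hM x.1 x.2 (by omega)
    rw [hx'] at h2
    linear_combination K x.1 x.2 * h2

theorem thetaFac_succ (x q p : ℂ) (n : ℕ) :
    thetaFac x q p (n + 1) = thetaFac x q p n * theta (x * q ^ n) p :=
  Finset.prod_range_succ _ _

theorem thetaFac_succ' (x q p : ℂ) (n : ℕ) :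
    thetaFac x q p (n + 1) = theta x p * thetaFac (x * q) q p n := by
  unfold thetaFac
  rw [Finset.prod_range_succ', pow_zero, mul_one, mul_comm]
  congr 1
  refine Finset.prod_congr rfl fun k _ => ?_
  rw [pow_succ', mul_assoc]

theorem thetaFac_zero (x q p : ℂ) : thetaFac x q p 0 = 1 := rfl

theorem thetaFac_add (x q p : ℂ) (m n : ℕ) :
    thetaFac x q p (m + n) = thetaFac x q p m * thetaFac (x * q ^ m) q p n := by
  unfold thetaFac
  rw [Finset.prod_range_add]
  simp_rw [pow_add, mul_assoc]

/-- The product `∏_{j=-m}^{k} θ(x q^j; p)`. -/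
def thetaFacTwoSided (x q p : ℂ) (k m : ℕ) : ℂ :=
  theta x p * thetaFac (x * q) q p k * ∏ i ∈ Finset.range m, theta (x / q ^ (i + 1)) p

/-- The reversed factorial `∏_{j<m} θ(x q^{-j}; p)`. -/
def thetaFacRev (x q p : ℂ) (m : ℕ) : ℂ := ∏ i ∈ Finset.range m, theta (x / q ^ i) p

theorem thetaFacRev_succ (x q p : ℂ) (m : ℕ) :
    thetaFacRev x q p (m + 1) = thetaFacRev x q p m * theta (x / q ^ m) p :=
  Finset.prod_range_succ _ _

/-- The coefficient of `∏_{j<k} g(d q^j) ∏_{j<m} g(f q^j)` in the expansion of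
`∏_{j<k+m} g(y q^j)`, for a symmetric theta function `g` of degree two. -/
def expansionCoeff (d f y q p : ℂ) (k m : ℕ) : ℂ :=
  (d / y) ^ k / q ^ (k * m) *
    (thetaFac q q p (k + m) / (thetaFac q q p k * thetaFac q q p m)) *
    (thetaFac (y / f) q p k * thetaFac (f * y * q ^ m) q p k) *
    (thetaFac (y * d * q ^ k) q p m * thetaFacRev (d / y) q p m) *
    (theta (d * q ^ k / (f * q ^ m)) p /
      (thetaFacTwoSided (d / f) q p k m * thetaFac (d * f) q p (k + m)))

/-- The coefficient of `g(d q^k)` in the expansion of `g(y q^(k+m))`. -/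
def stepLeft (d f y q p : ℂ) (k m : ℕ) : ℂ :=
  d / y / q ^ m * (theta (y * f * q ^ (k + 2 * m)) p * theta (y / f * q ^ k) p /
    (theta (d * f * q ^ (k + m)) p * theta (d * q ^ k / (f * q ^ m)) p))

/-- The coefficient of `g(f q^m)` in the expansion of `g(y q^(k+m))`. -/
def stepRight (d f y q p : ℂ) (k m : ℕ) : ℂ :=
  theta (d * y * q ^ (2 * k + m)) p * theta (d / y / q ^ m) p /
    (theta (d * f * q ^ (k + m)) p * theta (d * q ^ k / (f * q ^ m)) p)

section

variable {p q d f y : ℂ}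

theorem ThetaBasis.step (T : ThetaBasis p) (hp : ‖p‖ < 1) {s t : ℂ} {g : ℂ → ℂ}
    (hg : ∀ z, z ≠ 0 → g z = s * T.even z + t * T.odd z)
    (hq : q ≠ 0) (hd : d ≠ 0) (hf : f ≠ 0) (hy : y ≠ 0) {k m : ℕ}
    (h1 : theta (d * f * q ^ (k + m)) p ≠ 0) (h2 : theta (d * q ^ k / (f * q ^ m)) p ≠ 0) :
    g (y * q ^ (k + m)) = stepLeft d f y q p k m * g (d * q ^ k)
      + stepRight d f y q p k m * g (f * q ^ m) := by
  have h := T.three_term hg (b := d * q ^ k) (c := f * q ^ m) (x := y * q ^ (k + m))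
    (by positivity) (by positivity) (by positivity)
  have e1 : f * q ^ m * (d * q ^ k) = d * f * q ^ (k + m) := by ring
  have e2 : f * q ^ m / (d * q ^ k) = (d * q ^ k / (f * q ^ m))⁻¹ := by field_simp
  have e3 : f * q ^ m * (y * q ^ (k + m)) = y * f * q ^ (k + 2 * m) := by ring
  have e4 : f * q ^ m / (y * q ^ (k + m)) = (y / f * q ^ k)⁻¹ := by
    rw [pow_add]
    field_simp
  have e5 : d * q ^ k * (y * q ^ (k + m)) = d * y * q ^ (2 * k + m) := by ring
  have e6 : d * q ^ k / (y * q ^ (k + m)) = d / y / q ^ m := by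
    rw [pow_add]
    field_simp
  rw [e1, e2, e3, e4, e5, e6, theta_inv hp (by positivity), theta_inv hp (by positivity)] at h
  unfold stepLeft stepRight
  generalize g (y * q ^ (k + m)) = G0 at *
  generalize g (d * q ^ k) = G1 at *
  generalize g (f * q ^ m) = G2 at *
  generalize theta (d * q ^ k / (f * q ^ m)) p = t1 at *
  generalize theta (d * f * q ^ (k + m)) p = t2 at *
  generalize theta (y * f * q ^ (k + 2 * m)) p = t3 at *
  generalize theta (y / f * q ^ k) p = t4 at *
  generalize theta (d * y * q ^ (2 * k + m)) p = t5 at *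
  generalize theta (d / y / q ^ m) p = t6 at *
  field_simp at h ⊢
  linear_combination -h

theorem theta_shift_ne_zero (hq : q ≠ 0)
    (hδ : ∀ i : ℤ, theta (d / f * q ^ i) p ≠ 0) (k m : ℕ) :
    theta (d * q ^ k / (f * q ^ m)) p ≠ 0 := by
  have := hδ (k - m)
  rwa [zpow_sub₀ hq, zpow_natCast, zpow_natCast, div_mul_div_comm] at this

theorem thetaFacTwoSided_ne_zero {x : ℂ} (hx : ∀ i : ℤ, theta (x * q ^ i) p ≠ 0)
    (k m : ℕ) : thetaFacTwoSided x q p k m ≠ 0 := by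
  refine mul_ne_zero (mul_ne_zero (by simpa using hx 0) ?_) ?_
  · refine Finset.prod_ne_zero_iff.mpr fun i _ => ?_
    have := hx (i + 1 : ℕ)
    rwa [zpow_natCast, pow_succ', ← mul_assoc] at this
  · refine Finset.prod_ne_zero_iff.mpr fun i _ => ?_
    have := hx (-(i + 1 : ℕ))
    rwa [zpow_neg, zpow_natCast, ← div_eq_mul_inv] at this

theorem thetaFac_ne_zero {x : ℂ} (hx : ∀ i : ℕ, theta (x * q ^ i) p ≠ 0) (n : ℕ) :
    thetaFac x q p n ≠ 0 :=
  Finset.prod_ne_zero_iff.mpr fun i _ => hx i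

theorem thetaFacTwoSided_succ_left (x : ℂ) (k m : ℕ) :
    thetaFacTwoSided x q p (k + 1) m
      = thetaFacTwoSided x q p k m * theta (x * q ^ (k + 1)) p := by
  unfold thetaFacTwoSided
  rw [thetaFac_succ, pow_succ', ← mul_assoc x q]
  ring

theorem thetaFacTwoSided_succ_right (x : ℂ) (k m : ℕ) :
    thetaFacTwoSided x q p k (m + 1)
      = thetaFacTwoSided x q p k m * theta (x / q ^ (m + 1)) p := by
  unfold thetaFacTwoSided
  rw [Finset.prod_range_succ]
  ring

/-- On an axis only one path contributes, so the recursion has a single term and no theta relation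
is needed. -/
theorem expansionCoeff_zero_succ (hq : q ≠ 0) (hd : d ≠ 0) (hf : f ≠ 0) {m : ℕ}
    (hQ : thetaFac q q p (m + 1) ≠ 0) (hdf : ∀ i : ℕ, theta (d * f * q ^ i) p ≠ 0)
    (hδ : ∀ i : ℤ, theta (d / f * q ^ i) p ≠ 0) :
    expansionCoeff d f y q p 0 (m + 1) = stepRight d f y q p 0 m * expansionCoeff d f y q p 0 m := by
  have hD := thetaFacTwoSided_ne_zero hδ 0 m
  have hDF := thetaFac_ne_zero hdf m
  have n1 := hdf m
  have n2 := theta_shift_ne_zero hq hδ 0 m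
  have n3 := theta_shift_ne_zero hq hδ 0 (m + 1)
  have e1 : d * q ^ 0 / (f * q ^ (m + 1)) = d / f / q ^ (m + 1) := by field_simp
  have e2 : d * y * q ^ m = y * d * q ^ m := by ring
  rw [thetaFac_succ] at hQ
  obtain ⟨hQ0, hQ1⟩ := mul_ne_zero_iff.mp hQ
  unfold stepRight expansionCoeff
  simp only [zero_add, zero_mul, mul_zero, pow_zero, mul_one, thetaFac_zero] at *
  rw [thetaFac_succ q, thetaFac_succ (y * d), thetaFac_succ (d * f), thetaFacRev_succ,
    thetaFacTwoSided_succ_right, e1, e2]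
  rw [e1] at n3
  generalize theta (d / f / q ^ (m + 1)) p = t1 at *
  generalize theta (d * f * q ^ m) p = t2 at *
  generalize theta (d / (f * q ^ m)) p = t3 at *
  generalize theta (y * d * q ^ m) p = t4 at *
  generalize theta (d / y / q ^ m) p = t5 at *
  generalize theta (q * q ^ m) p = t6 at *
  field_simp

theorem expansionCoeff_succ_zero (hq : q ≠ 0) (hd : d ≠ 0) (hf : f ≠ 0) (hy : y ≠ 0) {k : ℕ}
    (hQ : thetaFac q q p (k + 1) ≠ 0) (hdf : ∀ i : ℕ, theta (d * f * q ^ i) p ≠ 0)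
    (hδ : ∀ i : ℤ, theta (d / f * q ^ i) p ≠ 0) :
    expansionCoeff d f y q p (k + 1) 0 = stepLeft d f y q p k 0 * expansionCoeff d f y q p k 0 := by
  have hD := thetaFacTwoSided_ne_zero hδ k 0
  have hDF := thetaFac_ne_zero hdf k
  have n1 := hdf k
  have n2 := theta_shift_ne_zero hq hδ k 0
  have n3 := theta_shift_ne_zero hq hδ (k + 1) 0
  have e1 : d * q ^ (k + 1) / f = d / f * q ^ (k + 1) := by field_simp
  have e2 : y * f * q ^ k = f * y * q ^ k := by ring
  rw [thetaFac_succ] at hQ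
  obtain ⟨hQ0, hQ1⟩ := mul_ne_zero_iff.mp hQ
  unfold stepLeft expansionCoeff
  simp only [add_zero, mul_zero, pow_zero, mul_one, div_one, thetaFac_zero] at *
  rw [thetaFac_succ q, thetaFac_succ (y / f), thetaFac_succ (f * y), thetaFac_succ (d * f),
    thetaFacTwoSided_succ_left, e1, e2]
  rw [e1] at n3
  rw [pow_succ (d / y)]
  generalize theta (d / f * q ^ (k + 1)) p = t1 at *
  generalize theta (d * f * q ^ k) p = t2 at *
  generalize theta (d * q ^ k / f) p = t3 at *
  generalize theta (f * y * q ^ k) p = t4 at *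
  generalize theta (y / f * q ^ k) p = t5 at *
  generalize theta (q * q ^ k) p = t6 at *
  field_simp

theorem expansionCoeff_succ_succ (hp : ‖p‖ < 1) (hq : q ≠ 0) (hd : d ≠ 0) (hf : f ≠ 0)
    (hy : y ≠ 0) {k m : ℕ}
    (hQk : thetaFac q q p (k + 1) ≠ 0) (hQm : thetaFac q q p (m + 1) ≠ 0)
    (hdf : ∀ i : ℕ, theta (d * f * q ^ i) p ≠ 0)
    (hδ : ∀ i : ℤ, theta (d / f * q ^ i) p ≠ 0) :
    expansionCoeff d f y q p (k + 1) (m + 1) =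
      stepLeft d f y q p k (m + 1) * expansionCoeff d f y q p k (m + 1)
      + stepRight d f y q p (k + 1) m * expansionCoeff d f y q p (k + 1) m := by
  -- After cancelling the common shifted factorials, the recursion is exactly this instance of
  -- Weierstrass' relation; the substitutions below match its arguments.
  have hW := theta_weierstrass' hp (s := y * d / q) (t := f * y / q) (u := q ^ (k + 1))
    (v := q ^ (m + 1)) (by positivity) (by positivity) (by positivity) (by positivity)
  have w1 : q ^ (k + 1) * q ^ (m + 1) = q * q ^ (k + m + 1) := by ring
  have w2 : y * d / q * q ^ (k + 1) * q ^ (m + 1) = y * d * q ^ (k + 1) * q ^ m := by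
    field_simp
    ring
  have w3 : f * y / q * q ^ (k + 1) * q ^ (m + 1) = f * y * q ^ (m + 1) * q ^ k := by
    field_simp
    ring
  have w4 : y * d / q * q ^ (k + 1) / (f * y / q * q ^ (m + 1))
      = d * q ^ (k + 1) / (f * q ^ (m + 1)) := by field_simp
  have w5 : y * d / q * q ^ (k + 1) = y * d * q ^ k := by
    field_simp
    ring
  have w6 : f * y / q * q ^ (k + 1) * (q ^ (m + 1)) ^ 2 = y * f * q ^ (k + 2 * (m + 1)) := by
    field_simp
    ring
  have w7 : y * d / q * q ^ (k + 1) / (f * y / q) = d / f * q ^ (k + 1) := by field_simp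
  have w8 : y * d / q * (q ^ (k + 1)) ^ 2 * q ^ (m + 1) = d * y * q ^ (2 * (k + 1) + m) := by
    field_simp
    ring
  have w9 : f * y / q * q ^ (m + 1) = f * y * q ^ m := by
    field_simp
    ring
  have w10 : y * d / q / (f * y / q * q ^ (m + 1)) = d / f / q ^ (m + 1) := by field_simp
  have v1 : theta (q ^ (k + 1)) p = theta (q * q ^ k) p := by rw [pow_succ']
  have v2 : theta (q ^ (m + 1)) p = theta (q * q ^ m) p := by rw [pow_succ']
  rw [w4, w6, w7, w8, w10, w1, w2, w3, w5, w9, v1, v2] at hW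
  have hD := thetaFacTwoSided_ne_zero hδ k m
  have hDF := thetaFac_ne_zero hdf (k + m + 1)
  have n1 := hdf (k + m + 1)
  have n2 := theta_shift_ne_zero hq hδ k (m + 1)
  have n3 := theta_shift_ne_zero hq hδ (k + 1) m
  have n4 : theta (d / f * q ^ (k + 1)) p ≠ 0 := by
    have := hδ (k + 1 : ℕ)
    rwa [zpow_natCast] at this
  have n5 : theta (d / f / q ^ (m + 1)) p ≠ 0 := by
    have := hδ (-(m + 1 : ℕ))
    rwa [zpow_neg, zpow_natCast, ← div_eq_mul_inv] at this
  rw [thetaFac_succ] at hQk hQm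
  obtain ⟨hQk0, hQk1⟩ := mul_ne_zero_iff.mp hQk
  obtain ⟨hQm0, hQm1⟩ := mul_ne_zero_iff.mp hQm
  have i1 : k + 1 + (m + 1) = k + m + 1 + 1 := by ring
  have i2 : k + (m + 1) = k + m + 1 := by ring
  have i3 : k + 1 + m = k + m + 1 := by ring
  have f1 : thetaFac (f * y * q ^ m) q p (k + 1)
      = theta (f * y * q ^ m) p * thetaFac (f * y * q ^ (m + 1)) q p k := by
    rw [thetaFac_succ', mul_assoc (f * y), ← pow_succ]
  have f2 : thetaFac (y * d * q ^ k) q p (m + 1)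
      = theta (y * d * q ^ k) p * thetaFac (y * d * q ^ (k + 1)) q p m := by
    rw [thetaFac_succ', mul_assoc (y * d), ← pow_succ]
  unfold stepLeft stepRight expansionCoeff
  rw [i1, i2, i3, f1, f2, thetaFac_succ q q p (k + m + 1), thetaFac_succ (d * f) q p (k + m + 1),
    thetaFac_succ q q p k, thetaFac_succ q q p m, thetaFac_succ (y / f),
    thetaFac_succ (f * y * q ^ (m + 1)), thetaFac_succ (y * d * q ^ (k + 1)),
    thetaFacRev_succ, thetaFacTwoSided_succ_right, thetaFacTwoSided_succ_right,
    thetaFacTwoSided_succ_left]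
  have x1 : (k + 1) * (m + 1) = k * (m + 1) + (m + 1) := by ring
  have x2 : (k + 1) * m = k * m + m := by ring
  have x3 : k * (m + 1) = k * m + k := by ring
  rw [x1, x2, x3]
  generalize thetaFac q q p (k + m + 1) = Qn at *
  generalize thetaFac q q p k = Qk at *
  generalize thetaFac q q p m = Qm at *
  generalize thetaFac (y / f) q p k = Y at *
  generalize thetaFac (f * y * q ^ (m + 1)) q p k = F at *
  generalize thetaFac (y * d * q ^ (k + 1)) q p m = E at *
  generalize thetaFacRev (d / y) q p m = FL at *
  generalize thetaFacTwoSided (d / f) q p k m = D at *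
  generalize thetaFac (d * f) q p (k + m + 1) = DF at *
  generalize theta (d / f / q ^ (m + 1)) p = t1 at *
  generalize theta (d / f * q ^ (k + 1)) p = t2 at *
  generalize theta (q * q ^ k) p = t3 at *
  generalize theta (d * f * q ^ (k + m + 1)) p = t4 at *
  generalize theta (d * q ^ k / (f * q ^ (m + 1))) p = t5 at *
  generalize theta (d * q ^ (k + 1) / (f * q ^ m)) p = t6 at *
  generalize theta (q * q ^ m) p = t7 at *
  generalize theta (q * q ^ (k + m + 1)) p = t8 at *
  generalize theta (y * d * q ^ (k + 1) * q ^ m) p = t9 at *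
  generalize theta (y * d * q ^ k) p = t10 at *
  generalize theta (f * y * q ^ (m + 1) * q ^ k) p = t11 at *
  generalize theta (f * y * q ^ m) p = t12 at *
  generalize theta (y * f * q ^ (k + 2 * (m + 1))) p = t13 at *
  generalize theta (d * y * q ^ (2 * (k + 1) + m)) p = t14 at *
  generalize theta (d * q ^ (k + 1) / (f * q ^ (m + 1))) p = t15 at *
  generalize theta (y / f * q ^ k) p = t16 at *
  generalize theta (d / y / q ^ m) p = t17 at *
  rw [pow_succ (d / y)]
  field_simp
  linear_combination (Qn * Y * t16 * F * E * FL * t17 * q ^ (m + 1) * q ^ (k * m + k)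
    * q ^ (k * m + m)) * hW

/-- Expansion of `∏_{j<n} g(y q^j)` for a symmetric theta function `g` of degree two and generic
parameters. -/
theorem ThetaBasis.prod_expansion (T : ThetaBasis p) (hp : ‖p‖ < 1) {s t : ℂ} {g : ℂ → ℂ}
    (hg : ∀ z, z ≠ 0 → g z = s * T.even z + t * T.odd z)
    (hq : q ≠ 0) (hd : d ≠ 0) (hf : f ≠ 0) (hy : y ≠ 0) {n : ℕ} (hQ : thetaFac q q p n ≠ 0)
    (hdf : ∀ i : ℕ, theta (d * f * q ^ i) p ≠ 0)
    (hδ : ∀ i : ℤ, theta (d / f * q ^ i) p ≠ 0) :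
    ∏ j ∈ Finset.range n, g (y * q ^ j) =
      ∑ x ∈ Finset.HasAntidiagonal.antidiagonal n, expansionCoeff d f y q p x.1 x.2 *
        ((∏ j ∈ Finset.range x.1, g (d * q ^ j)) * ∏ j ∈ Finset.range x.2, g (f * q ^ j)) := by
  have hQ' : ∀ k ≤ n, thetaFac q q p k ≠ 0 := fun k hk => by
    obtain ⟨l, rfl⟩ := Nat.exists_eq_add_of_le hk
    rw [thetaFac_add] at hQ
    exact left_ne_zero_of_mul hQ
  refine prod_eq_sum_antidiagonal _
    (fun k m => (∏ j ∈ Finset.range k, g (d * q ^ j)) * ∏ j ∈ Finset.range m, g (f * q ^ j))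
    (expansionCoeff d f y q p) (stepLeft d f y q p) (stepRight d f y q p) n ?_ ?_ ?_ ?_ ?_ n le_rfl
  · have h := hδ 0
    rw [zpow_zero, mul_one] at h
    simp [expansionCoeff, thetaFac_zero, thetaFacRev, thetaFacTwoSided, h]
  · intro k m _
    rw [T.step hp hg hq hd hf hy (hdf _) (theta_shift_ne_zero hq hδ k m),
      Finset.prod_range_succ, Finset.prod_range_succ]
    ring
  · exact fun m hm => expansionCoeff_zero_succ hq hd hf (hQ' _ hm) hdf hδ
  · exact fun k hk => expansionCoeff_succ_zero hq hd hf hy (hQ' _ hk) hdf hδ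
  · exact fun k m h => expansionCoeff_succ_succ hp hq hd hf hy (hQ' _ (by omega))
      (hQ' _ (by omega)) hdf hδ

end

/-! ### Specialization to the very-well-poised form and removal of genericity. -/

section

variable {p q : ℂ}

/-- Here `X = q^(1-k)/x`: reversing the product pairs each factor with the inverse argument, and
`theta_inv` applies. -/
theorem thetaFac_eq_mul_of_reflect (hp : ‖p‖ < 1) (hq : q ≠ 0) {x X : ℂ} (hx : x ≠ 0) {k : ℕ}
    (h : X * x * q ^ k = q) :
    thetaFac X q p k = (∏ j ∈ Finset.range k, -(x * q ^ j)⁻¹) * thetaFac x q p k := by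
  unfold thetaFac
  rw [← Finset.prod_range_reflect, ← Finset.prod_mul_distrib]
  refine Finset.prod_congr rfl fun j hj => ?_
  obtain ⟨l, rfl⟩ := Nat.exists_eq_add_of_lt (Finset.mem_range.mp hj)
  have e1 : j + l + 1 - 1 - j = l := by omega
  have e2 : X * q ^ l = (x * q ^ j)⁻¹ := by
    refine eq_inv_of_mul_eq_one_left (mul_left_cancel₀ hq ?_)
    calc q * (X * q ^ l * (x * q ^ j)) = X * x * q ^ (j + l + 1) := by ring
      _ = q * 1 := by rw [h, mul_one]
  rw [e1, e2, theta_inv hp (by positivity)]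
  field_simp

theorem thetaFacRev_eq_thetaFac (hq : q ≠ 0) {x X : ℂ} {m : ℕ} (h : X * q = x * q ^ m) :
    thetaFacRev X q p m = thetaFac x q p m := by
  unfold thetaFac thetaFacRev
  rw [← Finset.prod_range_reflect]
  refine Finset.prod_congr rfl fun j hj => ?_
  obtain ⟨l, rfl⟩ := Nat.exists_eq_add_of_lt (Finset.mem_range.mp hj)
  have e1 : j + l + 1 - 1 - j = l := by omega
  have e2 : X / q ^ l = x * q ^ j := by
    rw [div_eq_iff (by positivity)]
    refine mul_right_cancel₀ hq ?_
    rw [h]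
    ring
  rw [e1, e2]

theorem thetaFacTwoSided_eq_thetaFac (hq : q ≠ 0) (x : ℂ) (k m : ℕ) :
    thetaFacTwoSided x q p k m = thetaFac (x / q ^ m) q p (k + m + 1) := by
  induction m with
  | zero => simp [thetaFacTwoSided, thetaFac_succ']
  | succ m ih =>
    have e : x / q ^ (m + 1) * q = x / q ^ m := by
      field_simp
      ring
    rw [thetaFacTwoSided_succ_right, ih, ← add_assoc k, thetaFac_succ' (x / q ^ (m + 1)), e]
    ring

theorem prod_neg_inv_mul_prod_neg_inv (hq : q ≠ 0) {x x' : ℂ} (hx : x ≠ 0) (hx' : x' ≠ 0) (k : ℕ) :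
    (∏ j ∈ Finset.range k, -(x * q ^ j)⁻¹) * (∏ j ∈ Finset.range k, -(x' * q ^ j)⁻¹) * q ^ (k * k)
      = (q / (x * x')) ^ k := by
  induction k with
  | zero => simp
  | succ k ih =>
    rw [Finset.prod_range_succ, Finset.prod_range_succ, pow_succ (q / (x * x')), ← ih]
    have e : (k + 1) * (k + 1) = k * k + (k + k + 1) := by ring
    rw [e, pow_add q (k * k), pow_add q (k + k), pow_add q k]
    field_simp

/-- The coefficients of the terminating very-well-poised expansion, without the cubic theta shifted
factorials and multiplied by `(cz, c/z; q, p)_n`. -/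
def poisedCoeff (b c z q p : ℂ) (n k m : ℕ) : ℂ :=
  q ^ (n * k) * (c / b) ^ k *
    (theta (b * c * q ^ (2 * (k : ℤ) - 1)) p / theta (b * c * q⁻¹) p) *
    ((thetaFac (q ^ (-(n : ℤ))) q p k * thetaFac (b * c * q⁻¹) q p k *
        thetaFac (b * z) q p k * thetaFac (b / z) q p k) /
      (thetaFac q q p k * thetaFac (b * c * q ^ n) q p k)) *
    (thetaFac (c * z * q ^ k) q p m * thetaFac (c / z * q ^ k) q p m)

theorem poisedCoeff_eq (hp : ‖p‖ < 1) (hq : q ≠ 0) {b c z w : ℂ} (hb : b ≠ 0) (hc : c ≠ 0)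
    (hz : z ≠ 0) (hw : w ≠ 0) {n k m : ℕ} (hn : k + m = n) (hwq : w ^ 2 * q = q ^ n)
    (hQk : thetaFac q q p k ≠ 0) (hQm : thetaFac q q p m ≠ 0)
    (hcb : ∀ i : ℕ, theta (c / b * q ^ i) p ≠ 0)
    (hbc : ∀ i : ℤ, theta (b * c * q ^ i) p ≠ 0) :
    thetaFac (b * c) q p n * thetaFac (c / b) q p n *
      expansionCoeff (c * w) (b * w)⁻¹ (z / w) q p k m = poisedCoeff b c z q p n k m := by
  subst hn
  have hZ : w ^ 2 = q ^ (k + m) / q := by rw [← hwq]; field_simp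
  have a1 : c * w / (z / w) = c / z * w ^ 2 := by field_simp
  have a2 : z / w / (b * w)⁻¹ = b * z := by field_simp
  have a3 : (b * w)⁻¹ * (z / w) = z / b / w ^ 2 := by field_simp
  have a4 : z / w * (c * w) = c * z := by field_simp
  have a5 : c * w / (b * w)⁻¹ = b * c * w ^ 2 := by field_simp
  have a6 : c * w * (b * w)⁻¹ = c / b := by field_simp
  have a7 : c * w * q ^ k / ((b * w)⁻¹ * q ^ m) = b * c * q ^ (2 * (k : ℤ) - 1) := by
    rw [zpow_sub₀ hq, zpow_mul, zpow_one, zpow_natCast]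
    calc c * w * q ^ k / ((b * w)⁻¹ * q ^ m) = b * c * w ^ 2 * q ^ k / q ^ m := by field_simp
      _ = b * c * ((q ^ (2 : ℤ)) ^ k / q) := by
        rw [hZ, zpow_ofNat, ← pow_mul]
        field_simp
        ring
  have b1 : thetaFac (z / b / w ^ 2 * q ^ m) q p k
      = (∏ j ∈ Finset.range k, -(b / z * q ^ j)⁻¹) * thetaFac (b / z) q p k := by
    refine thetaFac_eq_mul_of_reflect hp hq (by positivity) ?_
    rw [hZ]
    field_simp
    ring
  -- The last `k` factors of `(q;q,p)_n` reflect to `(q^(-n);q,p)_k`.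
  have b2 : thetaFac q q p (k + m) = thetaFac q q p m *
      ((∏ j ∈ Finset.range k, -(q ^ (-((k + m : ℕ) : ℤ)) * q ^ j)⁻¹)
        * thetaFac (q ^ (-((k + m : ℕ) : ℤ))) q p k) := by
    rw [add_comm k m, thetaFac_add, add_comm m k]
    congr 1
    refine thetaFac_eq_mul_of_reflect hp hq (zpow_ne_zero _ hq) ?_
    rw [zpow_neg, zpow_natCast]
    field_simp
    ring
  have b3 : thetaFacRev (c / z * w ^ 2) q p m = thetaFac (c / z * q ^ k) q p m := by
    refine thetaFacRev_eq_thetaFac hq ?_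
    rw [hZ]
    field_simp
    ring
  have b4 : thetaFacTwoSided (b * c * w ^ 2) q p k m
      = thetaFac (b * c * q⁻¹ * q ^ k) q p (k + m + 1) := by
    rw [thetaFacTwoSided_eq_thetaFac hq]
    congr 1
    rw [hZ]
    field_simp
    ring
  -- Both sides are `(bc/q;q,p)_(2k+m+1)`, cut at different places. This trades the two-sided
  -- denominator for the poised factors.
  have b5 : thetaFac (b * c * q⁻¹) q p k * thetaFac (b * c * q⁻¹ * q ^ k) q p (k + m + 1)
      = theta (b * c * q⁻¹) p * thetaFac (b * c) q p (k + m)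
        * thetaFac (b * c * q ^ (k + m)) q p k := by
    have e : b * c * q⁻¹ * q = b * c := by field_simp
    rw [← thetaFac_add, show k + (k + m + 1) = (k + m + k) + 1 by ring, thetaFac_succ', e,
      thetaFac_add]
    ring
  have c1 := prod_neg_inv_mul_prod_neg_inv hq (x := b / z) (x' := q ^ (-((k + m : ℕ) : ℤ)))
    (by positivity) (zpow_ne_zero _ hq) k
  have n1 : theta (b * c * q⁻¹) p ≠ 0 := by simpa using hbc (-1)
  have n2 : thetaFac (c / b) q p (k + m) ≠ 0 := thetaFac_ne_zero hcb _
  have n3 : thetaFac (b * c * q ^ (k + m)) q p k ≠ 0 := by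
    refine thetaFac_ne_zero (fun i => ?_) k
    have := hbc ((k + m + i : ℕ) : ℤ)
    rwa [zpow_natCast, pow_add, ← mul_assoc] at this
  have n4 : thetaFac (b * c) q p (k + m) ≠ 0 := by
    refine thetaFac_ne_zero (fun i => ?_) _
    simpa using hbc i
  have n5 : thetaFac (b * c * q⁻¹ * q ^ k) q p (k + m + 1) ≠ 0 := by
    intro h
    rw [h, mul_zero] at b5
    exact mul_ne_zero (mul_ne_zero n1 n4) n3 b5.symm
  -- The two reflection prefactors combine with the explicit powers, cancelling `z` and leaving
  -- `q^(nk) (c/b)^k`.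
  have c2 : (c / z * w ^ 2) ^ k / q ^ (k * m) *
      ((∏ j ∈ Finset.range k, -(b / z * q ^ j)⁻¹)
        * ∏ j ∈ Finset.range k, -(q ^ (-((k + m : ℕ) : ℤ)) * q ^ j)⁻¹)
      = q ^ ((k + m) * k) * (c / b) ^ k := by
    rw [← eq_div_iff (by positivity)] at c1
    rw [c1, hZ, zpow_neg, zpow_natCast]
    have e1 : q ^ ((k + m) * k) = (q ^ (k + m)) ^ k := pow_mul _ _ _
    have e2 : q ^ (k * m) * q ^ (k * k) = (q ^ (k + m)) ^ k := by
      rw [← pow_add, ← pow_mul]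
      ring
    rw [e1, div_mul_div_comm, e2, ← mul_pow, ← mul_pow, ← div_pow]
    congr 1
    field_simp
  unfold expansionCoeff poisedCoeff
  rw [a1, a2, a3, a4, a5, a6, a7, b1, b2, b3, b4, ← c2]
  generalize theta (b * c * q ^ (2 * (k : ℤ) - 1)) p = t1 at *
  generalize theta (b * c * q⁻¹) p = t2 at *
  generalize thetaFac (b * c * q⁻¹ * q ^ k) q p (k + m + 1) = t3 at *
  generalize thetaFac (b * c * q⁻¹) q p k = t4 at *
  generalize thetaFac (b * c) q p (k + m) = t5 at *
  generalize thetaFac (b * c * q ^ (k + m)) q p k = t6 at *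
  generalize thetaFac (c / b) q p (k + m) = t7 at *
  generalize thetaFac (q ^ (-((k + m : ℕ) : ℤ))) q p k = t8 at *
  generalize (∏ j ∈ Finset.range k, -(b / z * q ^ j)⁻¹) = t9 at *
  generalize (∏ j ∈ Finset.range k, -(q ^ (-((k + m : ℕ) : ℤ)) * q ^ j)⁻¹) = t10 at *
  generalize thetaFac (c * z * q ^ k) q p m = t11 at *
  generalize thetaFac (c / z * q ^ k) q p m = t12 at *
  generalize thetaFac (b * z) q p k = t13 at *
  generalize thetaFac (b / z) q p k = t14 at *
  generalize thetaFac q q p k = t15 at *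
  generalize thetaFac q q p m = t16 at *
  generalize (c / z * w ^ 2) ^ k = t17 at *
  field_simp
  linear_combination -(t17 * t10 * t8 * t13 * t9 * t14 * t11 * t12 * t1) * b5

theorem continuousAt_thetaFac (hp : ‖p‖ < 1) (hq : q ≠ 0) {u : ℂ → ℂ} {x : ℂ}
    (hu : ContinuousAt u x) (hx : u x ≠ 0) (n : ℕ) :
    ContinuousAt (fun b => thetaFac (u b) q p n) x := by
  unfold thetaFac
  refine tendsto_finsetProd _ fun k _ => ?_
  exact ContinuousAt.comp (f := fun b => u b * q ^ k)
    (continuousAt_theta hp (mul_ne_zero hx (pow_ne_zero k hq))) (hu.mul continuousAt_const)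

theorem continuousAt_poisedCoeff (hp : ‖p‖ < 1) (hq : q ≠ 0) {b c z : ℂ} (hb : b ≠ 0)
    (hc : c ≠ 0) (hz : z ≠ 0) {n k m : ℕ} (hQk : thetaFac q q p k ≠ 0)
    (hbc : theta (b * c * q⁻¹) p ≠ 0) (hbcn : thetaFac (b * c * q ^ n) q p k ≠ 0) :
    ContinuousAt (fun b => poisedCoeff b c z q p n k m) b := by
  have hqi := inv_ne_zero hq
  have hbc0 := mul_ne_zero hb hc
  have hid : ContinuousAt (fun b : ℂ => b) b := continuousAt_id
  have hθ : ∀ s : ℂ, s ≠ 0 → ContinuousAt (fun b => theta (b * c * s) p) b := fun s hs =>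
    ContinuousAt.comp (f := fun b => b * c * s) (continuousAt_theta hp (mul_ne_zero hbc0 hs))
      (by fun_prop)
  have h1 := hθ (q ^ (2 * (k : ℤ) - 1)) (zpow_ne_zero _ hq)
  have h2 := hθ q⁻¹ hqi
  have h3 := continuousAt_thetaFac hp hq (u := fun b => b * c * q⁻¹) (x := b) (by fun_prop)
    (mul_ne_zero hbc0 hqi) k
  have h4 := continuousAt_thetaFac hp hq (u := fun b => b * z) (x := b) (by fun_prop)
    (mul_ne_zero hb hz) k
  have h5 := continuousAt_thetaFac hp hq (u := fun b => b / z) (x := b) (by fun_prop)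
    (div_ne_zero hb hz) k
  have h6 := continuousAt_thetaFac hp hq (u := fun b => b * c * q ^ n) (x := b) (by fun_prop)
    (mul_ne_zero hbc0 (pow_ne_zero n hq)) k
  unfold poisedCoeff
  exact (((continuousAt_const.mul ((continuousAt_const.div hid hb).pow k)).mul
    (h1.div h2 hbc)).mul ((((continuousAt_const.mul h3).mul h4).mul h5).div
    (continuousAt_const.mul h6) (mul_ne_zero hQk hbcn))).mul continuousAt_const

/-- Each condition excludes the preimage of a countable set under an injective map of `b`, and there
are countably many conditions. -/
theorem dense_generic (hp : ‖p‖ < 1) (hq : q ≠ 0) {c : ℂ} (hc : c ≠ 0) :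
    Dense {b : ℂ | b ≠ 0 ∧ (∀ i : ℕ, theta (c / b * q ^ i) p ≠ 0) ∧
      ∀ i : ℤ, theta (b * c * q ^ i) p ≠ 0} := by
  have hZ := countable_theta_eq_zero hp
  have h1 : ∀ i : ℕ, ((fun b : ℂ => c / b * q ^ i) ⁻¹' {x | x ≠ 0 ∧ theta x p = 0}).Countable :=
    fun i => hZ.preimage_of_injOn fun b _ b' _ h => by
      have h' := mul_right_cancel₀ (pow_ne_zero i hq) h
      rw [div_eq_mul_inv, div_eq_mul_inv] at h'
      exact inv_injective (mul_left_cancel₀ hc h')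
  have h2 : ∀ i : ℤ, ((fun b : ℂ => b * c * q ^ i) ⁻¹' {x | x ≠ 0 ∧ theta x p = 0}).Countable :=
    fun i => hZ.preimage_of_injOn fun b _ b' _ h =>
      mul_right_cancel₀ hc (mul_right_cancel₀ (zpow_ne_zero i hq) h)
  refine (Set.Countable.dense_compl ℂ (((Set.countable_singleton (0 : ℂ)).union
    (Set.countable_iUnion h1)).union (Set.countable_iUnion h2))).mono ?_
  intro b hb
  simp only [Set.mem_compl_iff, Set.mem_union, Set.mem_singleton_iff, Set.mem_iUnion,
    Set.mem_preimage, Set.mem_ofPred_eq, not_or, not_exists, not_and] at hb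
  obtain ⟨⟨hb0, hb1⟩, hb2⟩ := hb
  exact ⟨hb0, fun i => hb1 i (mul_ne_zero (div_ne_zero hc hb0) (pow_ne_zero i hq)),
    fun i => hb2 i (mul_ne_zero (mul_ne_zero hb0 hc) (zpow_ne_zero i hq))⟩

/-- The very-well-poised form of the expansion of `∏_{j<n} g(y q^j)`, for a symmetric theta function
`g` of degree two. -/
theorem ThetaBasis.poised_expansion (T : ThetaBasis p) (hp : ‖p‖ < 1) {s t : ℂ} {g : ℂ → ℂ}
    (hg : ∀ z, z ≠ 0 → g z = s * T.even z + t * T.odd z)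
    (hq : q ≠ 0) {b c z w : ℂ} (hb : b ≠ 0) (hc : c ≠ 0) (hz : z ≠ 0) (hw : w ≠ 0) {n : ℕ}
    (hwq : w ^ 2 * q = q ^ n) (hQ : thetaFac q q p n ≠ 0)
    (hbc : theta (b * c * q⁻¹) p ≠ 0) (hbcn : thetaFac (b * c * q ^ n) q p n ≠ 0) :
    thetaFac (b * c) q p n * thetaFac (c / b) q p n * ∏ j ∈ Finset.range n, g (z / w * q ^ j) =
      ∑ x ∈ Finset.HasAntidiagonal.antidiagonal n, poisedCoeff b c z q p n x.1 x.2 *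
        ((∏ j ∈ Finset.range x.1, g (c * w * q ^ j)) *
          ∏ j ∈ Finset.range x.2, g ((b * w)⁻¹ * q ^ j)) := by
  have hle : ∀ y k, k ≤ n → thetaFac y q p n ≠ 0 → thetaFac y q p k ≠ 0 := fun y k hk h => by
    obtain ⟨l, rfl⟩ := Nat.exists_eq_add_of_le hk
    rw [thetaFac_add] at h
    exact left_ne_zero_of_mul h
  let S : Set ℂ := {b : ℂ | b ≠ 0 ∧ (∀ i : ℕ, theta (c / b * q ^ i) p ≠ 0) ∧
      ∀ i : ℤ, theta (b * c * q ^ i) p ≠ 0}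
  have hS : Dense S := dense_generic hp hq hc
  let F : ℂ → ℂ := fun b =>
    thetaFac (b * c) q p n * thetaFac (c / b) q p n * ∏ j ∈ Finset.range n, g (z / w * q ^ j)
  let H : ℂ → ℂ := fun b =>
    ∑ x ∈ Finset.HasAntidiagonal.antidiagonal n, poisedCoeff b c z q p n x.1 x.2 *
        ((∏ j ∈ Finset.range x.1, g (c * w * q ^ j)) *
          ∏ j ∈ Finset.range x.2, g ((b * w)⁻¹ * q ^ j))
  -- The factor `(bc, c/b;q,p)_n` has cleared the denominators that vanish at non-generic `b`; those
  -- left in `H` are nonzero by hypothesis, so the identity extends from the dense set `S` by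
  -- continuity.
  have hFH : ∀ b ∈ S, F b = H b := by
    rintro b ⟨hb0, hb1, hb2⟩
    have hZ : c * w / (b * w)⁻¹ = b * c * q ^ ((n : ℤ) - 1) := by
      rw [zpow_sub_one₀ hq, zpow_natCast, ← hwq]
      field_simp
    have h := T.prod_expansion hp hg hq (d := c * w) (f := (b * w)⁻¹) (y := z / w)
      (by positivity) (by positivity) (by positivity) hQ
      (fun i => by
        have := hb1 i
        rwa [show c * w * (b * w)⁻¹ = c / b by field_simp])
      (fun i => by
        rw [hZ, mul_assoc, ← zpow_add₀ hq]
        exact hb2 _)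
    simp only [F, H]
    rw [h, Finset.mul_sum]
    refine Finset.sum_congr rfl fun x hx => ?_
    have hx' := Finset.HasAntidiagonal.mem_antidiagonal.mp hx
    rw [← poisedCoeff_eq hp hq hb0 hc hz hw hx' hwq (hle _ _ (by omega) hQ)
      (hle _ _ (by omega) hQ) hb1 hb2, mul_assoc _ (expansionCoeff _ _ _ _ _ _ _)]
  have hgc : ∀ {x : ℂ}, x ≠ 0 → ContinuousAt g x := fun {x} hx => by
    refine ((continuousAt_const.mul (T.continuousAt_even hx)).add
      (continuousAt_const.mul (T.continuousAt_odd hx)) : ContinuousAt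
        (fun z => s * T.even z + t * T.odd z) x).congr ?_
    filter_upwards [isOpen_ne.mem_nhds hx] with y hy
    exact (hg y hy).symm
  have hF : ContinuousAt F b :=
    ((continuousAt_thetaFac hp hq (u := fun b => b * c) (by fun_prop) (mul_ne_zero hb hc) n).mul
      (continuousAt_thetaFac hp hq (u := fun b => c / b) (continuousAt_const.div continuousAt_id hb)
        (div_ne_zero hc hb) n)).mul continuousAt_const
  have hH : ContinuousAt H b := by
    refine tendsto_finsetSum _ fun x hx => ?_
    have hx' := Finset.HasAntidiagonal.mem_antidiagonal.mp hx
    refine (continuousAt_poisedCoeff hp hq hb hc hz (hle _ _ (by omega) hQ) hbc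
      (hle _ _ (by omega) hbcn)).mul (continuousAt_const.mul ?_)
    refine tendsto_finsetProd _ fun j _ => ?_
    refine ContinuousAt.comp (f := fun b => (b * w)⁻¹ * q ^ j) (hgc (by positivity)) ?_
    exact ((continuousAt_id.mul continuousAt_const).inv₀ (mul_ne_zero hb hw)).mul continuousAt_const
  have : (𝓝[S] b).NeBot := mem_closure_iff_nhdsWithin_neBot.mp (hS b)
  refine tendsto_nhds_unique (f := F) (l := 𝓝[S] b) (hF.mono_left nhdsWithin_le_nhds) ?_
  refine (hH.mono_left nhdsWithin_le_nhds : Tendsto H (𝓝[S] b) (𝓝 (H b))).congr' ?_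
  filter_upwards [self_mem_nhdsWithin] with b hb
  exact (hFH b hb).symm

end

/-! ### Cubic factorials as products, and the conclusion. -/

theorem gamma_inv_left (z a p : ℂ) : gamma z⁻¹ a p = gamma z a p := by
  unfold gamma
  rw [← (Equiv.prodComm ℤ ℤ).tsum_eq]
  refine tsum_congr fun x => ?_
  obtain ⟨k, l⟩ := x
  have e1 : l ^ 2 + l * k + k ^ 2 = k ^ 2 + k * l + l ^ 2 := by ring
  have e2 : -(l - k) = k - l := by ring
  simp only [Equiv.prodComm_apply, Prod.swap_prod_mk]
  rw [inv_zpow', e1, e2, add_comm l k]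

/-- Absorbing the half-integer powers of `q` into `A` and `x` leaves the second argument of `gamma`
constant along the product. All the cubic factorials in the theorem then share `A = a w`, hence the
same `g`. -/
theorem cubicFac_eq_prod_gamma {q p A x X Y : ℂ} (hq : q ≠ 0) (hA : A ≠ 0) (hx : x ≠ 0) {n : ℕ}
    (hX : X = A * x) (hY : Y * q ^ n = A / x * q) :
    cubicFac X Y q p n = ∏ j ∈ Finset.range n, gamma (x * q ^ j) A p := by
  obtain ⟨r, rfl⟩ := IsAlgClosed.exists_pow_nat_eq q two_pos
  have hr : r ≠ 0 := by rintro rfl; simp at hq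
  have hs : r ^ ((n : ℤ) - 1) ≠ 0 := zpow_ne_zero _ hr
  have e1 : X = A / r ^ ((n : ℤ) - 1) * (x * r ^ ((n : ℤ) - 1)) := by
    rw [hX]
    field_simp
  have e2 : Y = A / r ^ ((n : ℤ) - 1) / (x * r ^ ((n : ℤ) - 1)) := by
    rw [← eq_div_iff (by positivity)] at hY
    rw [hY, zpow_sub_one₀ hr, zpow_natCast]
    field_simp
    ring
  rw [e1, e2, cubicFac_eq_prod_of_sq_eq (div_ne_zero hA hs) (mul_ne_zero hx hs) rfl]
  refine Finset.prod_congr rfl fun j _ => ?_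
  have e3 : x * r ^ ((n : ℤ) - 1) * r ^ (1 - (n : ℤ) + 2 * (j : ℤ)) = x * (r ^ 2) ^ j := by
    rw [mul_assoc, ← zpow_add₀ hr, ← pow_mul, ← zpow_natCast]
    congr 2
    push_cast
    ring
  rw [e3, div_mul_cancel₀ _ hs]

theorem poisedCoeff_div {b c z q p : ℂ} {n k m : ℕ} (hn : n = k + m)
    (hcz : thetaFac (c * z) q p n ≠ 0) (hcz' : thetaFac (c / z) q p n ≠ 0) :
    poisedCoeff b c z q p n k m / (thetaFac (c * z) q p n * thetaFac (c / z) q p n) =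
      q ^ (n * k) * (c / b) ^ k *
        (theta (b * c * q ^ (2 * (k : ℤ) - 1)) p / theta (b * c * q⁻¹) p) *
        ((thetaFac (q ^ (-(n : ℤ))) q p k * thetaFac (b * c * q⁻¹) q p k *
            thetaFac (b * z) q p k * thetaFac (b / z) q p k) /
          (thetaFac q q p k * thetaFac (b * c * q ^ n) q p k *
            thetaFac (c * z) q p k * thetaFac (c / z) q p k)) := by
  have f1 : thetaFac (c * z) q p n = thetaFac (c * z) q p k * thetaFac (c * z * q ^ k) q p m := by
    rw [hn, thetaFac_add]
  have f2 : thetaFac (c / z) q p n = thetaFac (c / z) q p k * thetaFac (c / z * q ^ k) q p m := by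
    rw [hn, thetaFac_add]
  rw [f1] at hcz ⊢
  rw [f2] at hcz' ⊢
  obtain ⟨g1, g2⟩ := mul_ne_zero_iff.mp hcz
  obtain ⟨g3, g4⟩ := mul_ne_zero_iff.mp hcz'
  unfold poisedCoeff
  generalize q ^ (n * k) * (c / b) ^ k *
    (theta (b * c * q ^ (2 * (k : ℤ) - 1)) p / theta (b * c * q⁻¹) p) = t0
  generalize thetaFac (q ^ (-(n : ℤ))) q p k * thetaFac (b * c * q⁻¹) q p k *
    thetaFac (b * z) q p k * thetaFac (b / z) q p k = t6
  generalize thetaFac (c * z * q ^ k) q p m = t1 at *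
  generalize thetaFac (c / z * q ^ k) q p m = t2 at *
  generalize thetaFac (c * z) q p k = t3 at *
  generalize thetaFac (c / z) q p k = t4 at *
  generalize thetaFac q q p k * thetaFac (b * c * q ^ n) q p k = t5
  field_simp

end CubicTheta

end

theorem corollary3p2 (n : ℕ) (a b c z q p : ℂ) (hp : ‖p‖ < 1)
    (ha : a ≠ 0) (hb : b ≠ 0) (hc : c ≠ 0) (hz : z ≠ 0) (hq : q ≠ 0)
    (hcz : CubicTheta.thetaFac (c * z) q p n ≠ 0)
    (hcz' : CubicTheta.thetaFac (c / z) q p n ≠ 0)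
    (hbc : CubicTheta.theta (b * c * q⁻¹) p ≠ 0)
    (hqn : CubicTheta.thetaFac q q p n ≠ 0)
    (hbcn : CubicTheta.thetaFac (b * c * q ^ n) q p n ≠ 0)
    (hcub : ∀ k ≤ n, CubicTheta.cubicFac (a * b * q ^ n) (a * q ^ (-(k : ℤ)) / b) q p k ≠ 0) :
    CubicTheta.thetaFac (b * c) q p n * CubicTheta.thetaFac (c / b) q p n *
        (CubicTheta.cubicFac (a * z) (a / z) q p n /
          (CubicTheta.thetaFac (c * z) q p n * CubicTheta.thetaFac (c / z) q p n)) =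
      ∑ k ∈ Finset.range (n + 1),
        q ^ (n * k) * (c / b) ^ k *
          (CubicTheta.theta (b * c * q ^ (2 * (k : ℤ) - 1)) p /
            CubicTheta.theta (b * c * q⁻¹) p) *
          ((CubicTheta.thetaFac (q ^ (-(n : ℤ))) q p k *
              CubicTheta.thetaFac (b * c * q⁻¹) q p k *
              CubicTheta.thetaFac (b * z) q p k * CubicTheta.thetaFac (b / z) q p k) /
            (CubicTheta.thetaFac q q p k * CubicTheta.thetaFac (b * c * q ^ n) q p k *
              CubicTheta.thetaFac (c * z) q p k * CubicTheta.thetaFac (c / z) q p k)) *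
          CubicTheta.cubicFac (a * c * q ^ ((n : ℤ) - 1)) (a * q ^ (1 - (k : ℤ)) / c) q p k *
          (CubicTheta.cubicFac (a * b * q ^ k) (a * q ^ (-(k : ℤ)) / b) q p n /
            CubicTheta.cubicFac (a * b * q ^ n) (a * q ^ (-(k : ℤ)) / b) q p k) := by
  open CubicTheta in
  obtain ⟨T⟩ := nonempty_thetaBasis hp
  obtain ⟨r, hr⟩ := IsAlgClosed.exists_pow_nat_eq q two_pos
  have hr0 : r ≠ 0 := by rintro rfl; simp at hr; exact hq hr.symm
  -- `w` is `q^((n-1)/2)`; the integer exponent also covers `n = 0`.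
  obtain ⟨w, hw⟩ : ∃ w : ℂ, w = r ^ ((n : ℤ) - 1) := ⟨_, rfl⟩
  have hw0 : w ≠ 0 := hw ▸ zpow_ne_zero _ hr0
  have hwq : w ^ 2 * q = q ^ n := by
    rw [hw, zpow_sub_one₀ hr0, zpow_natCast, ← hr]
    field_simp
    ring
  have hA : a * w ≠ 0 := mul_ne_zero ha hw0
  obtain ⟨s, t, hg⟩ := T.gamma_eq hA
  have hmain := T.poised_expansion hp hg hq hb hc hz hw0 hwq hqn hbc hbcn
  have hL : cubicFac (a * z) (a / z) q p n
      = ∏ j ∈ Finset.range n, gamma (z / w * q ^ j) (a * w) p := by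
    refine cubicFac_eq_prod_gamma hq hA (div_ne_zero hz hw0) (by field_simp) ?_
    rw [← hwq]
    field_simp
  rw [hL, ← mul_div_assoc, hmain, Finset.Nat.sum_antidiagonal_eq_sum_range_succ (fun k m =>
    poisedCoeff b c z q p n k m * ((∏ j ∈ Finset.range k, gamma (c * w * q ^ j) (a * w) p) *
      ∏ j ∈ Finset.range m, gamma ((b * w)⁻¹ * q ^ j) (a * w) p)), Finset.sum_div]
  refine Finset.sum_congr rfl fun k hk => ?_
  have hkn : k ≤ n := Nat.lt_succ_iff.mp (Finset.mem_range.mp hk)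
  obtain ⟨m, hm⟩ := Nat.exists_eq_add_of_le hkn
  have hnm : n - k = m := by omega
  rw [hnm]
  have h2 : cubicFac (a * c * q ^ ((n : ℤ) - 1)) (a * q ^ (1 - (k : ℤ)) / c) q p k
      = ∏ j ∈ Finset.range k, gamma (c * w * q ^ j) (a * w) p := by
    refine cubicFac_eq_prod_gamma hq hA (mul_ne_zero hc hw0) ?_ ?_
    · rw [zpow_sub_one₀ hq, zpow_natCast, ← hwq]
      field_simp
    · rw [zpow_sub₀ hq, zpow_natCast, zpow_one]
      field_simp
  have h3 : cubicFac (a * b * q ^ k) (a * q ^ (-(k : ℤ)) / b) q p n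
      = ∏ j ∈ Finset.range n, gamma (b / w * q ^ k * q ^ j) (a * w) p := by
    refine cubicFac_eq_prod_gamma hq hA (by positivity) (by field_simp) ?_
    rw [zpow_neg, zpow_natCast, ← hwq]
    field_simp
  have h4 : cubicFac (a * b * q ^ n) (a * q ^ (-(k : ℤ)) / b) q p k
      = ∏ j ∈ Finset.range k, gamma (b / w * q ^ n * q ^ j) (a * w) p := by
    refine cubicFac_eq_prod_gamma hq hA (by positivity) (by field_simp) ?_
    rw [zpow_neg, zpow_natCast, ← hwq]
    field_simp
  -- The last `k` factors are the denominator. As `w² = q^(n-1)`, the first `m` arguments, read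
  -- backwards, are the inverses of `(b w)⁻¹ q^j`, and `gamma` is invariant under inversion.
  have h5 : ∏ j ∈ Finset.range n, gamma (b / w * q ^ k * q ^ j) (a * w) p
      = (∏ j ∈ Finset.range m, gamma ((b * w)⁻¹ * q ^ j) (a * w) p)
        * ∏ j ∈ Finset.range k, gamma (b / w * q ^ n * q ^ j) (a * w) p := by
    have e : n = m + k := by omega
    nth_rewrite 1 [e]
    rw [Finset.prod_range_add]
    congr 1
    · rw [← Finset.prod_range_reflect]
      refine Finset.prod_congr rfl fun j hj => ?_
      obtain ⟨l, hl⟩ := Nat.exists_eq_add_of_lt (Finset.mem_range.mp hj)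
      have e1 : m - 1 - j = l := by omega
      have e2 : b / w * q ^ k * q ^ l = ((b * w)⁻¹ * q ^ j)⁻¹ := by
        have e3 : w ^ 2 * q = q ^ k * q ^ l * q ^ j * q := by
          rw [hwq, hm, hl]
          ring
        have e4 := mul_right_cancel₀ hq e3
        field_simp
        rw [e4]
      rw [e1, e2, gamma_inv_left]
    · refine Finset.prod_congr rfl fun j _ => ?_
      rw [hm]
      congr 1
      ring
  have h6 := hcub k hkn
  rw [h4] at h6
  rw [h2, h3, h5, h4, mul_div_cancel_right₀ _ h6]
  rw [mul_div_right_comm, poisedCoeff_div hm hcz hcz']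
  ring
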